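/- **Theorem 1.7 (Reflexivity Theorem).** Let $X\subset\mathbb P^n$ be an irreducible (Zariski closed, non-empty) complex projective variety. Let $\mathrm{Cone}(X)\subset\mathbb C^{n+1}$ be the affine cone over $X$. For a smooth point $x$ of $X$, represented by a nonzero vector $v$, let $\hat T_xX=\mathbb P(T_v\mathrm{Cone}(X))\subset\mathbb P^n$ be the embedded tangent space. A hyperplane $H\subset\mathbb P^n$, i.e. a point of the dual projective space $\mathbb P^{n*}$, is *tangent to $X$ at $x$* if $\hat T_xX\subset H$. The dual variety $X^*\subset\mathbb P^{n*}$ is the Zariski closure of the set of all hyperplanes tangent to $X$ at some smooth point of $X$; thus $(\mathbb P^n)^*=\emptyset$, and by convention $\emptyset^*=\mathbb P^n$. The bidual space $\mathbb P^{n**}$ is identified with $\mathbb P^n$ by sending a point $z\in\mathbb P^n$ to the hyperplane of $\mathbb P^{n*}$ consisting of all hyperplanes through $z$. Then: (a) $X^{**}=X$. (b) If $z$ is a smooth point of $X$ and $H$ is a smooth point of $X^*$, then $H$ is tangent to $X$ at $z$ if and only if $z$, regarded as a hyperplane in $\mathbb P^{n*}$, is tangent to $X^*$ at $H$. -/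

import Mathlib

open scoped LinearAlgebra.Projectivization

namespace ProjDual

/-- Complex projective space `ℙⁿ = ℙ(ℂⁿ⁺¹)`. -/
abbrev ProjSpace (n : ℕ) : Type := ℙ ℂ (Fin (n + 1) → ℂ)

/-- The common zeros in `ℙⁿ` of a set of polynomials (used only for homogeneous polynomials, for
which the vanishing at a point does not depend on the representative of the point). -/
def projZeroLocus {n : ℕ} (S : Set (MvPolynomial (Fin (n + 1)) ℂ)) : Set (ProjSpace n) :=
  {x | ∀ p ∈ S, MvPolynomial.eval x.rep p = 0}

/-- A subset of `ℙⁿ` is algebraic if it is cut out by homogeneous polynomials. -/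
def IsAlgebraicSet {n : ℕ} (X : Set (ProjSpace n)) : Prop :=
  ∃ S : Set (MvPolynomial (Fin (n + 1)) ℂ),
    (∀ p ∈ S, ∃ d : ℕ, p.IsHomogeneous d) ∧ X = projZeroLocus S

/-- The Zariski topology on `ℙⁿ`: the closed sets are the algebraic sets. -/
instance zariskiTopology (n : ℕ) : TopologicalSpace (ProjSpace n) :=
  TopologicalSpace.ofClosed {X | IsAlgebraicSet X}
    (by
      refine ⟨{1}, ?_, ?_⟩
      · intro p hp
        rw [Set.mem_singleton_iff] at hp
        exact ⟨0, hp ▸ MvPolynomial.isHomogeneous_one _ _⟩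
      · ext x
        simp [projZeroLocus])
    (by
      intro A hA
      refine ⟨⋃ X : A, (hA X.2).choose, ?_, ?_⟩
      · intro p hp
        obtain ⟨X, hX⟩ := Set.mem_iUnion.1 hp
        exact (hA X.2).choose_spec.1 p hX
      · ext x
        constructor
        · intro hx p hp
          obtain ⟨X, hX⟩ := Set.mem_iUnion.1 hp
          have h := hx X.1 X.2
          rw [(hA X.2).choose_spec.2] at h
          exact h p hX
        · intro hx X hX
          rw [(hA hX).choose_spec.2]
          intro p hp
          exact hx p (Set.mem_iUnion.2 ⟨⟨X, hX⟩, hp⟩))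
    (by
      rintro X ⟨S, hS, rfl⟩ Y ⟨T, hT, rfl⟩
      refine ⟨{r | ∃ p ∈ S, ∃ q ∈ T, r = p * q}, ?_, ?_⟩
      · rintro r ⟨p, hp, q, hq, rfl⟩
        obtain ⟨d, hd⟩ := hS p hp
        obtain ⟨e, he⟩ := hT q hq
        exact ⟨d + e, hd.mul he⟩
      · ext x
        constructor
        · rintro (hx | hx) r ⟨p, hp, q, hq, rfl⟩
          · rw [map_mul, hx p hp, zero_mul]
          · rw [map_mul, hx q hq, mul_zero]
        · intro hx
          by_contra hc
          simp only [Set.mem_union, projZeroLocus, Set.mem_ofPred_eq, not_or, not_forall] at hc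
          obtain ⟨⟨p, hp, hpx⟩, ⟨q, hq, hqx⟩⟩ := hc
          have h := hx (p * q) ⟨p, hp, q, hq, rfl⟩
          rw [map_mul] at h
          exact (mul_ne_zero hpx hqx) h)

/-- An irreducible projective variety in `ℙⁿ`: a Zariski closed irreducible (in particular
nonempty) subset. -/
def IsIrreducibleVariety {n : ℕ} (X : Set (ProjSpace n)) : Prop :=
  IsClosed X ∧ IsIrreducible X

/-- The affine cone over `X`: the union of the lines `l` with `ℙ(l) ∈ X`, together with `0`. -/
def cone {n : ℕ} (X : Set (ProjSpace n)) : Set (Fin (n + 1) → ℂ) :=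
  {v | ∀ hv : v ≠ 0, Projectivization.mk ℂ v hv ∈ X}

/-- The ideal of all polynomials vanishing on the affine cone over `X`. -/
noncomputable def coneIdeal {n : ℕ} (X : Set (ProjSpace n)) :
    Ideal (MvPolynomial (Fin (n + 1)) ℂ) :=
  MvPolynomial.vanishingIdeal ℂ (cone X)

/-- `x` is a smooth point of `X`: it lies on `X`, and the coordinate ring `ℂ[Cone(X)]` is smooth
over `ℂ` at the maximal ideal of the nonzero vector representing `x`. Since `Cone(X) ∖ {0} → X` is
a locally trivial `ℂˣ`-bundle, this is smoothness of `X` at `x`, and it does not depend on the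
choice of the vector. -/
def IsSmoothPoint {n : ℕ} (X : Set (ProjSpace n)) (x : ProjSpace n) : Prop :=
  x ∈ X ∧
    ∃ P ∈ Algebra.smoothLocus ℂ (MvPolynomial (Fin (n + 1)) ℂ ⧸ coneIdeal X),
      P.asIdeal.comap (Ideal.Quotient.mk (coneIdeal X)) = MvPolynomial.vanishingIdeal ℂ {x.rep}

/-- The tangent space `T_v Cone(X)`, as a linear subspace of `ℂⁿ⁺¹`: the common kernel of the
differentials at `v` of the polynomials vanishing on `Cone(X)`. -/
noncomputable def coneTangentSpace {n : ℕ} (X : Set (ProjSpace n)) (v : Fin (n + 1) → ℂ) :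
    Submodule ℂ (Fin (n + 1) → ℂ) where
  carrier := {w | ∀ p ∈ coneIdeal X,
    ∑ i, MvPolynomial.eval v (MvPolynomial.pderiv i p) * w i = 0}
  add_mem' := by
    intro a b ha hb p hp
    simp only [Pi.add_apply, mul_add, Finset.sum_add_distrib]
    rw [ha p hp, hb p hp, add_zero]
  zero_mem' := by
    intro p _
    simp
  smul_mem' := by
    intro c a ha p hp
    simp only [Pi.smul_apply, smul_eq_mul, mul_left_comm _ c, ← Finset.mul_sum]
    rw [ha p hp, mul_zero]

/-- The embedded projective tangent space `ℙ(T_v Cone(X)) ⊆ ℙⁿ`, where `v` represents `x`. -/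
def embeddedTangentSpace {n : ℕ} (X : Set (ProjSpace n)) (x : ProjSpace n) :
    Set (ProjSpace n) :=
  {y | y.submodule ≤ coneTangentSpace X x.rep}

/-- The hyperplane `a₀x₀ + ⋯ + aₙxₙ = 0` of `ℙⁿ` with coefficient vector `(a₀ : ⋯ : aₙ)`. Through
these coefficients the dual projective space, whose points are the hyperplanes of `ℙⁿ`, is `ℙⁿ`
with the dual homogeneous coordinates. The equation being symmetric in `a` and `x`, the hyperplane
of the dual space attached to a point `z` of `ℙⁿ`, which consists of the hyperplanes through `z`,
is `hyperplane z`, so that the bidual space is identified with `ℙⁿ` in the canonical way. -/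
def hyperplane {n : ℕ} (a : ProjSpace n) : Set (ProjSpace n) :=
  {x | Projectivization.orthogonal a x}

/-- The hyperplane `H` is tangent to `X` at `x`: it contains the embedded tangent space at `x`. -/
def IsTangentAt {n : ℕ} (X : Set (ProjSpace n)) (x H : ProjSpace n) : Prop :=
  embeddedTangentSpace X x ⊆ hyperplane H

open Classical in
/-- The dual variety of `X ⊆ ℙⁿ`, in the dual projective space: the Zariski closure of the set of
hyperplanes that are tangent to `X` at some smooth point of `X`. (The dual of `ℙⁿ` is empty, and
conversely the dual of the empty set, whose cone is `{0}`, is the whole space.) -/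
noncomputable def dualVariety {n : ℕ} (X : Set (ProjSpace n)) : Set (ProjSpace n) :=
  if X = ∅ then Set.univ
  else closure {H | ∃ x, IsSmoothPoint X x ∧ IsTangentAt X x H}

end ProjDual

/-! The conormal variety of `X`, the closure of the pairs (smooth point, tangent hyperplane), is
symmetric in the two factors; both claims follow. The symmetry is proved at a generic point. Let `x`
be the generic point of the cone, with coordinates in a field `K` over `ℂ`, and let `h` be a
combination of a basis of gradients at `x`, with coefficients forming a transcendence basis of `K`
over `ℂ[x]` (`exists_isGenericConormal`). Then `(x, h)` is a generic point of the conormal variety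
of the cone.

By Euler's formula `x ⬝ᵥ h = 0`. A tangent vector `w` at `h` of the locus of `h` has the form `D h`
for a derivation `D` of `K`, by characteristic zero. Differentiating `x ⬝ᵥ h = 0` gives `x ⬝ᵥ w + h
⬝ᵥ D x = 0`, and `h ⬝ᵥ D x = 0` since `h` is conormal and `D x` tangent at `x`. Hence `x` is
conormal at `h` (`IsGenericConormal.mem_conormalSpace`). As `K` has transcendence degree `n + 1`,
counting parameters shows that `x` is even generic conormal at `h` (`IsGenericConormal.symm`).

Smooth vectors are dense in the cone, so the ideal of the dual variety is the ideal of `h`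
(`coneIdeal_tangentHyperplanes`). Applied to `(h, x)`, this gives (a). For (b), the tangent
dimension at a smooth point equals the generic one, so `H` is tangent at `z` exactly when `(z, H)`
satisfies every polynomial relation satisfied by `(x, h)` (`isTangentAt_iff_of_isGenericConormal`),
a symmetric condition. When no hyperplane is tangent, `h = 0` and `X` is the whole space. -/

open scoped TensorProduct

namespace ProjDual

/-! ### Gradients, tangent vectors and derivations. -/

section Gradient

variable {k κ σ : Type*} [Field k] [Field κ] [Algebra k κ] [Fintype σ]

/-- The gradient of a polynomial at a point. -/
noncomputable def gradient (x : σ → κ) (p : MvPolynomial σ k) : σ → κ :=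
  fun i => MvPolynomial.aeval x (MvPolynomial.pderiv i p)

/-- The span of the gradients at `x` of the polynomials in `I`. -/
noncomputable def conormalSpace (I : Ideal (MvPolynomial σ k)) (x : σ → κ) :
    Submodule κ (σ → κ) :=
  Submodule.span κ (gradient x '' (I : Set (MvPolynomial σ k)))

/-- The common kernel of the differentials at `x` of the polynomials in `I`. -/
noncomputable def tangentSpace (I : Ideal (MvPolynomial σ k)) (x : σ → κ) :
    Submodule κ (σ → κ) where
  carrier := {w | ∀ p ∈ I, gradient x p ⬝ᵥ w = 0}
  add_mem' ha hb p hp := by rw [dotProduct_add, ha p hp, hb p hp, add_zero]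
  zero_mem' p _ := dotProduct_zero _
  smul_mem' c a ha p hp := by rw [dotProduct_smul, ha p hp, smul_zero]

theorem mem_tangentSpace {I : Ideal (MvPolynomial σ k)} {x w : σ → κ} :
    w ∈ tangentSpace I x ↔ ∀ p ∈ I, gradient x p ⬝ᵥ w = 0 := Iff.rfl

omit [Fintype σ] in
theorem gradient_mul (x : σ → κ) (p q : MvPolynomial σ k) :
    gradient x (p * q) =
      MvPolynomial.aeval x p • gradient x q + MvPolynomial.aeval x q • gradient x p := by
  ext i
  simp [gradient, Derivation.leibniz]

omit [Fintype σ] in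
theorem aeval_algebraMap_fun {A B : Type*} [CommRing A] [Algebra k A] [CommRing B] [Algebra k B]
    [Algebra A B] [IsScalarTower k A B] (a : σ → A) (p : MvPolynomial σ k) :
    MvPolynomial.aeval (fun i => algebraMap A B (a i)) p =
      algebraMap A B (MvPolynomial.aeval a p) :=
  MvPolynomial.aeval_algebraMap_apply B a p

theorem derivation_aeval {A M : Type*} [CommRing A] [Algebra k A] [AddCommGroup M] [Module k M]
    [Module A M] (D : Derivation k A M) (x : σ → A)
    (p : MvPolynomial σ k) :
    D (MvPolynomial.aeval x p) =
      ∑ i, MvPolynomial.aeval x (MvPolynomial.pderiv i p) • D (x i) := by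
  classical
  induction p using MvPolynomial.induction_on with
  | C a => simp
  | add p q hp hq => simp [hp, hq, add_smul, Finset.sum_add_distrib]
  | mul_X p j hp =>
    simp only [map_mul, MvPolynomial.aeval_X, Derivation.leibniz, hp, MvPolynomial.pderiv_X,
      smul_eq_mul, map_add, add_smul, Finset.sum_add_distrib, Finset.smul_sum, smul_smul]
    congr 1
    rw [Finset.sum_eq_single j]
    · simp
    · intro b _ hb
      simp [Pi.single_eq_of_ne hb.symm]
    · simp

/-- Lift an element of `A` to a polynomial and pair its gradient with `w`. Since `w` kills the
gradients of the relations, the choice of lift does not matter, and the Leibniz rule is the product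
rule for gradients. -/
theorem exists_derivation_of_mem_tangentSpace {A : Type*} [CommRing A] [Algebra k A] [Algebra A κ]
    [IsScalarTower k A κ] (a : σ → A)
    (ha : Function.Surjective (MvPolynomial.aeval a : MvPolynomial σ k →ₐ[k] A))
    {w : σ → κ}
    (hw : w ∈ tangentSpace (RingHom.ker (MvPolynomial.aeval a : MvPolynomial σ k →ₐ[k] A))
      (fun i => algebraMap A κ (a i))) :
    ∃ D : Derivation k A κ, ∀ i, D (a i) = w i := by
  classical
  set x : σ → κ := fun i => algebraMap A κ (a i)
  have hx (p : MvPolynomial σ k) :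
      MvPolynomial.aeval x p = algebraMap A κ (MvPolynomial.aeval a p) := by
    exact aeval_algebraMap_fun a p
  have key (p q : MvPolynomial σ k) (h : MvPolynomial.aeval a p = MvPolynomial.aeval a q) :
      gradient x p ⬝ᵥ w = gradient x q ⬝ᵥ w := by
    have := hw (p - q) (by rw [RingHom.mem_ker, map_sub, h, sub_self])
    rw [← sub_eq_zero, ← sub_dotProduct, ← this]
    congr 1
    ext i
    simp [gradient]
  let s := Function.surjInv ha
  have hs (b : A) : MvPolynomial.aeval a (s b) = b := Function.surjInv_eq ha b
  let D0 : A →ₗ[k] κ :=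
    { toFun := fun b => gradient x (s b) ⬝ᵥ w
      map_add' := fun b c => by
        rw [key (s (b + c)) (s b + s c) (by simp [hs]), ← add_dotProduct]
        congr 1
        ext i
        simp [gradient]
      map_smul' := fun r b => by
        rw [key (s (r • b)) (r • s b) (by simp [hs]), RingHom.id_apply, ← smul_dotProduct]
        congr 1
        ext i
        simp [gradient] }
  refine ⟨Derivation.mk' D0 fun b c => ?_, fun i => ?_⟩
  · change gradient x (s (b * c)) ⬝ᵥ w = b • (gradient x (s c) ⬝ᵥ w) + c • (gradient x (s b) ⬝ᵥ w)
    rw [key (s (b * c)) (s b * s c) (by simp [hs]), gradient_mul, add_dotProduct,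
      smul_dotProduct, smul_dotProduct, hx, hx, hs, hs, algebraMap_smul, algebraMap_smul]
  · change gradient x (s (a i)) ⬝ᵥ w = w i
    rw [key (s (a i)) (MvPolynomial.X i) (by simp [hs])]
    simp [gradient, dotProduct, MvPolynomial.pderiv_X, Pi.single_apply, apply_ite,
      Finset.sum_ite_eq]

/-- Tangent vectors are derivations `A → κ`, hence `B`-linear forms on `Ω[B⁄k]`, because formal
étaleness makes `Ω[B⁄k]` the base change of `Ω[A⁄k]`. The ring `B` will be a fraction field or the
local ring of a smooth point. -/
theorem finrank_tangentSpace {A B ι : Type*} [CommRing A] [Algebra k A] [CommRing B]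
    [Algebra k B] [Algebra A B] [IsScalarTower k A B] [Algebra.FormallyEtale A B]
    [Algebra A κ] [IsScalarTower k A κ] [Algebra B κ] [IsScalarTower A B κ]
    [IsScalarTower k B κ] [Fintype ι] (b : Module.Basis ι B Ω[B⁄k]) (a : σ → A)
    (ha : Function.Surjective (MvPolynomial.aeval a : MvPolynomial σ k →ₐ[k] A)) :
    Module.finrank κ
      (tangentSpace (RingHom.ker (MvPolynomial.aeval a : MvPolynomial σ k →ₐ[k] A))
        (fun i => algebraMap A κ (a i))) = Fintype.card ι := by
  classical
  have hb := KaehlerDifferential.isBaseChange_of_formallyEtale k A B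
  let d (i : σ) : Ω[B⁄k] := KaehlerDifferential.D k B (algebraMap A B (a i))
  -- The values of a linear form on the basis are sent to its values on the differentials of the
  -- coordinates.
  let T : (ι → κ) →ₗ[κ] (σ → κ) :=
    (Matrix.of fun i j => algebraMap B κ (b.repr (d i) j)).mulVecLin
  have hT (c : ι → κ) (i : σ) : T c i = b.constr B c (d i) := by
    rw [b.constr_apply_fintype B]
    simp [T, Matrix.mulVec, dotProduct, Algebra.smul_def]
  have hinj : Function.Injective T := by
    rw [← LinearMap.ker_eq_bot, LinearMap.ker_eq_bot']
    intro c hc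
    have h0 : b.constr B c = 0 := by
      refine hb.algHom_ext _ _ fun y => ?_
      let ℓ : Ω[A⁄k] →ₗ[A] κ :=
        ((b.constr B c : Ω[B⁄k] →ₗ[B] κ).restrictScalars A) ∘ₗ KaehlerDifferential.map k k A B
      have : ℓ = 0 := by
        refine LinearMap.ext_on_range (v := KaehlerDifferential.D k A)
          (KaehlerDifferential.span_range_derivation k A) fun y => ?_
        obtain ⟨p, rfl⟩ := ha y
        rw [derivation_aeval, map_sum, map_sum]
        refine Finset.sum_congr rfl fun i _ => ?_
        rw [map_smul, map_smul]
        congr 1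
        simp only [ℓ, LinearMap.comp_apply, KaehlerDifferential.map_D, LinearMap.zero_apply,
          LinearMap.restrictScalars_apply]
        rw [← hT, hc]
        rfl
      exact LinearMap.congr_fun this y
    ext j
    have := LinearMap.congr_fun h0 (b j)
    simpa using this
  have hrange : LinearMap.range T =
      tangentSpace (RingHom.ker (MvPolynomial.aeval a : MvPolynomial σ k →ₐ[k] A))
        (fun i => algebraMap A κ (a i)) := by
    apply le_antisymm
    · rintro _ ⟨c, rfl⟩ p hp
      have h1 : KaehlerDifferential.D k B (MvPolynomial.aeval (fun i => algebraMap A B (a i)) p)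
          = 0 := by
        rw [aeval_algebraMap_fun, (RingHom.mem_ker).1 hp]
        simp
      rw [derivation_aeval] at h1
      have h2 := congrArg (b.constr B c) h1
      rw [map_sum, map_zero] at h2
      rw [← h2, dotProduct]
      refine Finset.sum_congr rfl fun i _ => ?_
      rw [hT, map_smul, Algebra.smul_def]
      congr 1
      rw [gradient, aeval_algebraMap_fun, aeval_algebraMap_fun,
        ← IsScalarTower.algebraMap_apply]
    · intro w hw
      obtain ⟨D, hD⟩ := exists_derivation_of_mem_tangentSpace a ha hw
      let ℓ : Ω[B⁄k] →ₗ[B] κ := hb.lift D.liftKaehlerDifferential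
      refine ⟨fun j => ℓ (b j), ?_⟩
      ext i
      rw [hT]
      have : b.constr B (fun j => ℓ (b j)) = ℓ := b.constr_self B ℓ
      rw [this, ← hD]
      have h3 := hb.lift_eq D.liftKaehlerDifferential (KaehlerDifferential.D k A (a i))
      rwa [KaehlerDifferential.map_D, Derivation.liftKaehlerDifferential_comp_D] at h3
  rw [← hrange, LinearMap.finrank_range_of_inj hinj, Module.finrank_fintype_fun_eq_card]

end Gradient

/-! ### Derivations and differentials of field extensions. -/

section Fields

/-- Formal smoothness kills `H1Cotangent`, so `K ⊗ Ω[A⁄k]` injects into `Ω[K⁄k]`; over a field this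
injection has a linear retraction, along which the derivation extends. -/
theorem exists_derivation_extension {k A K : Type*} [Field k] [CommRing A] [Field K] [Algebra k A]
    [Algebra A K] [Algebra k K] [IsScalarTower k A K] [Algebra.FormallySmooth A K]
    (d : Derivation k A K) : ∃ D : Derivation k K K, ∀ a, D (algebraMap A K a) = d a := by
  have hinj : Function.Injective (KaehlerDifferential.mapBaseChange k A K) := by
    rw [injective_iff_map_eq_zero]
    intro x hx
    obtain ⟨x, rfl⟩ := (Algebra.H1Cotangent.exact_δ_mapBaseChange k A K x).mp hx
    rw [Subsingleton.elim x 0, map_zero]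
  obtain ⟨g, hg⟩ := LinearMap.exists_leftInverse_of_injective _ (LinearMap.ker_eq_bot.2 hinj)
  let ℓ : K ⊗[A] Ω[A⁄k] →ₗ[K] K := d.liftKaehlerDifferential.liftBaseChange K
  refine ⟨(ℓ ∘ₗ g).compDer (KaehlerDifferential.D k K), fun a => ?_⟩
  have h1 : KaehlerDifferential.D k K (algebraMap A K a) =
      KaehlerDifferential.mapBaseChange k A K (1 ⊗ₜ KaehlerDifferential.D k A a) := by simp
  change ℓ (g (KaehlerDifferential.D k K (algebraMap A K a))) = d a
  rw [h1]
  have h2 := LinearMap.congr_fun hg (1 ⊗ₜ KaehlerDifferential.D k A a)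
  simp only [LinearMap.comp_apply, LinearMap.id_apply] at h2
  rw [h2]
  simp [ℓ]

open scoped IntermediateField.algebraAdjoinAdjoin in
-- In characteristic zero `L` is separable algebraic, hence formally étale, over the rational
-- function field on a transcendence basis. So `Ω[L⁄k]` is the base change of the differentials of a
-- polynomial ring.
theorem exists_basis_kaehlerDifferential (k L : Type*) [Field k] [CharZero k] [Field L]
    [Algebra k L] :
    ∃ s : Set L, IsTranscendenceBasis k ((↑) : s → L) ∧
      Nonempty (Module.Basis s L Ω[L⁄k]) := by
  obtain ⟨s, hs⟩ := exists_isTranscendenceBasis k L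
  refine ⟨s, hs, ?_⟩
  have := hs.isAlgebraic_field
  have : CharZero (IntermediateField.adjoin k (Set.range ((↑) : s → L))) :=
    charZero_of_injective_algebraMap (algebraMap k _).injective
  have : Algebra.FormallyEtale (IntermediateField.adjoin k (Set.range ((↑) : s → L))) L :=
    Algebra.FormallyEtale.of_isSeparable _ L
  have : Algebra.FormallyEtale (Algebra.adjoin k (Set.range ((↑) : s → L)))
      (IntermediateField.adjoin k (Set.range ((↑) : s → L))) :=
    .of_isLocalization (nonZeroDivisors _)
  have h2 : Algebra.FormallyEtale (Algebra.adjoin k (Set.range ((↑) : s → L))) L :=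
    .comp _ (IntermediateField.adjoin k (Set.range ((↑) : s → L))) _
  let e := hs.1.aevalEquiv
  let _ : Algebra (MvPolynomial s k) (Algebra.adjoin k (Set.range ((↑) : s → L))) :=
    e.toAlgHom.toRingHom.toAlgebra
  let _ : Algebra (MvPolynomial s k) L :=
    ((algebraMap (Algebra.adjoin k (Set.range ((↑) : s → L))) L).comp
      e.toAlgHom.toRingHom).toAlgebra
  have : IsScalarTower (MvPolynomial s k) (Algebra.adjoin k (Set.range ((↑) : s → L))) L :=
    .of_algebraMap_eq fun _ => rfl
  have : IsScalarTower k (MvPolynomial s k) L := .of_algebraMap_eq fun r => by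
    change _ = algebraMap (Algebra.adjoin k (Set.range ((↑) : s → L))) L
      (e (algebraMap k (MvPolynomial s k) r))
    rw [AlgEquiv.commutes, ← IsScalarTower.algebraMap_apply]
  let e' : MvPolynomial s k ≃ₐ[MvPolynomial s k] (Algebra.adjoin k (Set.range ((↑) : s → L))) :=
    AlgEquiv.ofRingEquiv (f := e.toRingEquiv) fun _ => rfl
  have : Algebra.FormallyEtale (MvPolynomial s k)
      (Algebra.adjoin k (Set.range ((↑) : s → L))) := .of_equiv e'
  have : Algebra.FormallyEtale (MvPolynomial s k) L :=
    .comp _ (Algebra.adjoin k (Set.range ((↑) : s → L))) _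
  exact ⟨IsBaseChange.basis (KaehlerDifferential.mvPolynomialBasis k s)
    (KaehlerDifferential.isBaseChange_of_formallyEtale k (MvPolynomial s k) L)⟩

end Fields

/-! ### Duality between conormal and tangent spaces. -/

section LinearAlgebra

variable {k κ σ : Type*} [Field k] [Field κ] [Algebra k κ] [Fintype σ]

theorem tangentSpace_eq_comap [DecidableEq σ] (I : Ideal (MvPolynomial σ k)) (x : σ → κ) :
    tangentSpace I x =
      (conormalSpace I x).dualAnnihilator.comap (dotProductEquiv κ σ).toLinearMap := by
  ext w
  rw [Submodule.mem_comap, conormalSpace, Submodule.mem_dualAnnihilator, mem_tangentSpace]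
  constructor
  · intro h u hu
    change w ⬝ᵥ u = 0
    induction hu using Submodule.span_induction with
    | mem u hu =>
      obtain ⟨p, hp, rfl⟩ := hu
      rw [dotProduct_comm]
      exact h p hp
    | zero => exact dotProduct_zero _
    | add a b _ _ ha hb => rw [dotProduct_add, ha, hb, add_zero]
    | smul c a _ ha => rw [dotProduct_smul, ha, smul_zero]
  · intro h p hp
    rw [dotProduct_comm]
    exact h _ (Submodule.subset_span ⟨p, hp, rfl⟩)

theorem mem_conormalSpace_iff (I : Ideal (MvPolynomial σ k)) (x u : σ → κ) :
    u ∈ conormalSpace I x ↔ ∀ w ∈ tangentSpace I x, u ⬝ᵥ w = 0 := by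
  classical
  rw [tangentSpace_eq_comap]
  constructor
  · intro hu w hw
    rw [Submodule.mem_comap, Submodule.mem_dualAnnihilator] at hw
    rw [dotProduct_comm]
    exact hw u hu
  · intro h
    rw [← Subspace.dualAnnihilator_dualCoannihilator_eq (W := conormalSpace I x),
      Submodule.mem_dualCoannihilator]
    intro φ hφ
    obtain ⟨w, rfl⟩ := (dotProductEquiv κ σ).surjective φ
    have := h w hφ
    rwa [dotProduct_comm] at this

theorem finrank_conormalSpace_add_finrank_tangentSpace (I : Ideal (MvPolynomial σ k))
    (x : σ → κ) :
    Module.finrank κ (conormalSpace I x) + Module.finrank κ (tangentSpace I x) =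
      Fintype.card σ := by
  classical
  have h := Subspace.finrank_add_finrank_dualAnnihilator_eq (conormalSpace I x)
  rw [Module.finrank_fintype_fun_eq_card] at h
  rw [← h, tangentSpace_eq_comap]
  congr 1
  erw [Submodule.comap_equiv_eq_map_symm]
  exact LinearEquiv.finrank_map_eq _ _

theorem exists_gradient_basis (I : Ideal (MvPolynomial σ k)) (x : σ → κ) :
    ∃ p : Fin (Module.finrank κ (conormalSpace I x)) → MvPolynomial σ k, (∀ i, p i ∈ I) ∧
      LinearIndependent κ (fun i => gradient x (p i)) ∧
      Submodule.span κ (Set.range fun i => gradient x (p i)) = conormalSpace I x := by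
  obtain ⟨f, hf, hs, hl⟩ := Submodule.exists_fun_fin_finrank_span_eq κ
    (gradient x '' (I : Set (MvPolynomial σ k)))
  choose p hp hpf using hf
  have : f = fun i => gradient x (p i) := funext fun i => (hpf i).symm
  subst this
  exact ⟨p, hp, hl, hs⟩

theorem exists_matrix_rightInverse {m : Type*} [Fintype m] [DecidableEq m] (G : Matrix m σ κ)
    (hG : LinearIndependent κ G.row) : ∃ C : Matrix σ m κ, G * C = 1 := by
  classical
  rw [← Matrix.vecMul_injective_iff] at hG
  have h1 : Function.Injective G.transpose.mulVecLin := by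
    intro a b hab
    apply hG
    simpa [Matrix.mulVec_transpose] using hab
  obtain ⟨g, hg⟩ := LinearMap.exists_leftInverse_of_injective _ (LinearMap.ker_eq_bot.2 h1)
  refine ⟨(LinearMap.toMatrix' g).transpose, ?_⟩
  have h2 := congrArg LinearMap.toMatrix' hg
  rw [LinearMap.toMatrix'_comp, LinearMap.toMatrix'_id] at h2
  have h3 : LinearMap.toMatrix' G.transpose.mulVecLin = G.transpose := by
    rw [← Matrix.toLin'_apply', LinearMap.toMatrix'_toLin']
  rw [h3] at h2
  have h4 := congrArg Matrix.transpose h2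
  rwa [Matrix.transpose_mul, Matrix.transpose_transpose, Matrix.transpose_one] at h4

end LinearAlgebra

/-! ### Generic points, their derivations and their transcendence degree. -/

section Algebraic

/-- Only the images in `K` matter: the coefficients of an annihilating polynomial can be lifted to
`R₂`. This compares subrings of `K` that carry no algebra structure over one another. -/
theorem isAlgebraic_of_range_subset {R₁ R₂ K : Type*} [CommRing R₁] [CommRing R₂] [Field K]
    [Algebra R₁ K] [Algebra R₂ K] [FaithfulSMul R₁ K]
    (h : ∀ a : R₁, ∃ b : R₂, algebraMap R₂ K b = algebraMap R₁ K a) {z : K}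
    (hz : IsAlgebraic R₁ z) : IsAlgebraic R₂ z := by
  obtain ⟨f, hf0, hf⟩ := hz
  have hl : f.map (algebraMap R₁ K) ∈ Polynomial.lifts (algebraMap R₂ K) := by
    rw [Polynomial.lifts_iff_coeff_lifts]
    intro n
    obtain ⟨b, hb⟩ := h (f.coeff n)
    exact ⟨b, by rw [hb, Polynomial.coeff_map]⟩
  obtain ⟨g, hg⟩ := hl
  rw [Polynomial.coe_mapRingHom] at hg
  refine ⟨g, ?_, ?_⟩
  · rintro rfl
    rw [Polynomial.map_zero, eq_comm,
      Polynomial.map_eq_zero_iff (FaithfulSMul.algebraMap_injective R₁ K)] at hg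
    exact hf0 hg
  · rw [Polynomial.aeval_def, ← Polynomial.eval_map, hg, Polynomial.eval_map,
      ← Polynomial.aeval_def, hf]

variable (k : Type*) {K σ : Type*} [Field k] [Field K] [Algebra k K]

/-- The ideal of the polynomials vanishing at `x`. -/
noncomputable abbrev idealAt (x : σ → K) : Ideal (MvPolynomial σ k) :=
  RingHom.ker (MvPolynomial.aeval x : MvPolynomial σ k →ₐ[k] K)

/-- The algebra generated by the coordinates of `x`. -/
noncomputable abbrev coordRing (x : σ → K) : Subalgebra k K :=
  (MvPolynomial.aeval x : MvPolynomial σ k →ₐ[k] K).range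

/-- The coordinates of `x`, as elements of the algebra they generate. -/
noncomputable def coord (x : σ → K) (i : σ) : coordRing k x :=
  ⟨x i, MvPolynomial.X i, by simp⟩

variable {k}

theorem coe_aeval_coord (x : σ → K) (p : MvPolynomial σ k) :
    ((MvPolynomial.aeval (coord k x) p : coordRing k x) : K) = MvPolynomial.aeval x p :=
  (aeval_algebraMap_fun (B := K) (coord k x) p).symm

theorem aeval_coord_surjective (x : σ → K) :
    Function.Surjective (MvPolynomial.aeval (coord k x) :
      MvPolynomial σ k →ₐ[k] coordRing k x) := by
  rintro ⟨_, p, rfl⟩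
  exact ⟨p, Subtype.ext (coe_aeval_coord x p)⟩

theorem ker_aeval_coord (x : σ → K) :
    RingHom.ker (MvPolynomial.aeval (coord k x) : MvPolynomial σ k →ₐ[k] coordRing k x) =
      idealAt k x := by
  ext p
  rw [RingHom.mem_ker, RingHom.mem_ker, ← coe_aeval_coord, ZeroMemClass.coe_eq_zero]

/-- The derivation first lives on `k[x]`. It extends to `K`, which is formally smooth over the
fraction field of `k[x]` by characteristic zero and finite generation. -/
theorem exists_derivation_of_mem_tangentSpace_idealAt [CharZero k] [Fintype σ]
    [Algebra.EssFiniteType k K] (x : σ → K) {w : σ → K}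
    (hw : w ∈ tangentSpace (idealAt k x) x) : ∃ D : Derivation k K K, ∀ i, D (x i) = w i := by
  rw [← ker_aeval_coord] at hw
  obtain ⟨d, hd⟩ := exists_derivation_of_mem_tangentSpace (coord k x) (aeval_coord_surjective x) hw
  let _ := FractionRing.liftAlgebra (coordRing k x) K
  have := FractionRing.isScalarTower_liftAlgebra (coordRing k x) K
  have : IsScalarTower k (FractionRing (coordRing k x)) K :=
    .of_algebraMap_eq fun r => by
      rw [IsScalarTower.algebraMap_apply k (coordRing k x) (FractionRing (coordRing k x)),
        ← IsScalarTower.algebraMap_apply (coordRing k x) (FractionRing (coordRing k x)) K]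
      rfl
  have : Algebra.EssFiniteType (FractionRing (coordRing k x)) K :=
    .of_comp k (FractionRing (coordRing k x)) K
  have : CharZero (FractionRing (coordRing k x)) :=
    charZero_of_injective_algebraMap (algebraMap k _).injective
  have : Algebra.FormallySmooth (coordRing k x) (FractionRing (coordRing k x)) :=
    .of_isLocalization (nonZeroDivisors _)
  have : Algebra.FormallySmooth (coordRing k x) K :=
    .comp _ (FractionRing (coordRing k x)) _
  obtain ⟨D, hD⟩ := exists_derivation_extension d
  exact ⟨D, fun i => by rw [← hd, ← hD]; rfl⟩

/-- A generic point is smooth: the tangent dimension there is the rank of the differentials of the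
function field, that is, the dimension of the locus. -/
theorem finrank_tangentSpace_idealAt [CharZero k] [Fintype σ] (x : σ → K) :
    (Module.finrank K (tangentSpace (idealAt k x) x) : Cardinal) =
      Algebra.trdeg k (coordRing k x) := by
  let _ := FractionRing.liftAlgebra (coordRing k x) K
  have := FractionRing.isScalarTower_liftAlgebra (coordRing k x) K
  have : IsScalarTower k (FractionRing (coordRing k x)) K :=
    .of_algebraMap_eq fun r => by
      rw [IsScalarTower.algebraMap_apply k (coordRing k x) (FractionRing (coordRing k x)),
        ← IsScalarTower.algebraMap_apply (coordRing k x) (FractionRing (coordRing k x)) K]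
      rfl
  have : Algebra.FiniteType k (coordRing k x) :=
    .of_surjective (MvPolynomial.aeval (coord k x)) (aeval_coord_surjective x)
  have halg : Algebra.IsAlgebraic (coordRing k x) (FractionRing (coordRing k x)) :=
    IsFractionRing.comap_isAlgebraic_iff.mpr
      (inferInstance : Algebra.IsAlgebraic (FractionRing (coordRing k x)) _)
  have htr := trdeg_add_eq k (coordRing k x) (A := FractionRing (coordRing k x))
  rw [trdeg_eq_zero (R := coordRing k x), add_zero] at htr
  obtain ⟨s, hs, ⟨b⟩⟩ := exists_basis_kaehlerDifferential k (FractionRing (coordRing k x))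
  have hcard := hs.cardinalMk_eq_trdeg
  have hfin : Finite s := by
    rw [← Cardinal.mk_lt_aleph0_iff, hcard, ← htr]
    exact trdeg_lt_aleph0_of_finiteType
  have := Fintype.ofFinite s
  have : Algebra.FormallyEtale (coordRing k x) (FractionRing (coordRing k x)) :=
    .of_isLocalization (nonZeroDivisors _)
  have h := finrank_tangentSpace (κ := K) b (coord k x) (aeval_coord_surjective x)
  rw [ker_aeval_coord] at h
  rw [htr, ← hcard, Cardinal.mk_fintype, ← h]
  rfl

theorem trdeg_coordRing_add (x : σ → K) :
    Algebra.trdeg k (coordRing k x) + Algebra.trdeg (coordRing k x) K = Algebra.trdeg k K :=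
  trdeg_add_eq k (coordRing k x)

end Algebraic

/-! ### Generic conormal vectors and their symmetry. -/

section Generic

variable (k : Type*) {K σ : Type*} [Field k] [Field K] [Algebra k K] [Fintype σ]

/-- `h` is a generic conormal vector at `x`: a combination of a basis of the conormal space, with
coefficients forming a transcendence basis over the coordinate ring of `x`. -/
def IsGenericConormal (x h : σ → K) : Prop :=
  ∃ (p : Fin (Module.finrank K (conormalSpace (idealAt k x) x)) → MvPolynomial σ k)
    (s : Fin (Module.finrank K (conormalSpace (idealAt k x) x)) → K),
    (∀ i, p i ∈ idealAt k x) ∧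
    LinearIndependent K (fun i => gradient x (p i)) ∧
    Submodule.span K (Set.range fun i => gradient x (p i)) = conormalSpace (idealAt k x) x ∧
    IsTranscendenceBasis (coordRing k x) s ∧
    h = ∑ i, s i • gradient x (p i)

variable {k}

omit [Fintype σ] in
theorem gradient_mem_adjoin (x : σ → K) (p : MvPolynomial σ k) (i : σ) :
    gradient x p i ∈ Algebra.adjoin k (Set.range x) := by
  rw [Algebra.adjoin_range_eq_range_aeval]
  exact ⟨_, rfl⟩

/-- The gradients have entries in `k(x)` and are independent, so the linear system expressing `h`
through them is solved over `k(x, h)` by a right inverse matrix. -/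
theorem coeff_mem_adjoin {m : Type*} [Fintype m] {x h : σ → K} {p : m → MvPolynomial σ k}
    {s : m → K} (hp : LinearIndependent K fun i => gradient x (p i))
    (hh : h = ∑ i, s i • gradient x (p i)) (j : m) :
    s j ∈ IntermediateField.adjoin k (Set.range x ∪ Set.range h) := by
  classical
  set E := IntermediateField.adjoin k (Set.range x ∪ Set.range h)
  have hG (i : m) (a : σ) : gradient x (p i) a ∈ E :=
    IntermediateField.algebra_adjoin_le_adjoin k _
      (Algebra.adjoin_mono Set.subset_union_left (gradient_mem_adjoin x (p i) a))
  have hE (a : σ) : h a ∈ E := IntermediateField.subset_adjoin k _ (Or.inr ⟨a, rfl⟩)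
  let G : Matrix m σ E := Matrix.of fun i a => ⟨gradient x (p i) a, hG i a⟩
  have hind : LinearIndependent E G.row := by
    rw [Fintype.linearIndependent_iff] at hp ⊢
    intro c hc i
    have := hp (fun i => (c i : K)) (by
      ext a
      have := congrArg (fun e : E => (e : K)) (congrFun hc a)
      simpa [G] using this) i
    exact_mod_cast this
  obtain ⟨C, hC⟩ := exists_matrix_rightInverse G hind
  have h1 : h = Matrix.vecMul s (G.map (algebraMap E K)) := by
    rw [hh]
    ext a
    simp [Matrix.vecMul, dotProduct, G]
  have h2 : Matrix.vecMul h (C.map (algebraMap E K)) = s := by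
    rw [h1, Matrix.vecMul_vecMul, ← Matrix.map_mul, hC, Matrix.map_one _ (map_zero _) (map_one _),
      Matrix.vecMul_one]
  rw [← h2]
  exact sum_mem fun a _ => mul_mem (hE a) (C a j).2

/-- The point `x` contributes the dimension of the tangent space, the coefficients that of the
conormal space. The total is independent of the dimension of the locus, as the symmetry requires. -/
theorem IsGenericConormal.trdeg_eq [CharZero k] {x h : σ → K} (H : IsGenericConormal k x h) :
    Algebra.trdeg k K = Fintype.card σ := by
  obtain ⟨p, s, -, -, -, hs, -⟩ := H
  have h1 := hs.lift_cardinalMk_eq_trdeg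
  rw [Cardinal.mk_fin, Cardinal.lift_natCast, eq_comm, Cardinal.lift_uzero] at h1
  have h2 := trdeg_coordRing_add (k := k) x
  rw [← h2, h1, ← finrank_tangentSpace_idealAt, ← Nat.cast_add, add_comm,
    finrank_conormalSpace_add_finrank_tangentSpace]

theorem IsGenericConormal.mem_conormalSpace [CharZero k] [Algebra.EssFiniteType k K]
    {x h : σ → K} (H : IsGenericConormal k x h) (hxh : x ⬝ᵥ h = 0) :
    x ∈ conormalSpace (idealAt k h) h := by
  obtain ⟨p, s, hp, -, -, -, hh⟩ := H
  rw [mem_conormalSpace_iff]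
  intro w hw
  obtain ⟨D, hD⟩ := exists_derivation_of_mem_tangentSpace_idealAt h hw
  -- `D x` is tangent at `x`, as one sees by applying `D` to `p (x) = 0`, and `h` is conormal there.
  have h1 : ∑ i, h i * D (x i) = 0 := by
    have h2 (j) : ∑ i, gradient x (p j) i * D (x i) = 0 := by
      have h3 := derivation_aeval D x (p j)
      rw [(RingHom.mem_ker).1 (hp j), map_zero] at h3
      exact h3.symm
    simp only [hh, Finset.sum_apply, Pi.smul_apply, smul_eq_mul, Finset.sum_mul]
    rw [Finset.sum_comm]
    refine Finset.sum_eq_zero fun j _ => ?_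
    simp only [mul_assoc, ← Finset.mul_sum, h2, mul_zero]
  have h2 := congrArg D hxh
  rw [dotProduct, map_sum, map_zero] at h2
  simp only [Derivation.leibniz, smul_eq_mul, Finset.sum_add_distrib, h1, add_zero, hD] at h2
  exact h2

theorem IsGenericConormal.symm [CharZero k] [Algebra.EssFiniteType k K] {x h : σ → K}
    (H : IsGenericConormal k x h) (hxh : x ⬝ᵥ h = 0) : IsGenericConormal k h x := by
  have hmem := H.mem_conormalSpace hxh
  have htr := H.trdeg_eq
  obtain ⟨p, s, hp, hpl, -, hs, hh⟩ := H
  obtain ⟨q, hq, hql, hqs⟩ := exists_gradient_basis (idealAt k h) h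
  rw [← hqs] at hmem
  obtain ⟨t, ht⟩ := (Submodule.mem_span_range_iff_exists_fun K).1 hmem
  refine ⟨q, t, hq, hql, hqs, ?_, ht.symm⟩
  -- It suffices that `K` be algebraic over `R`: the family `t` has as many members as the
  -- transcendence degree over `k[h]` allows, so it is then a transcendence basis.
  let R := Algebra.adjoin (coordRing k h) (Set.range t)
  have hcoord (a : K) (ha : a ∈ coordRing k h) : a ∈ R :=
    R.algebraMap_mem ⟨a, ha⟩
  have hhR (i : σ) : h i ∈ R := hcoord _ ⟨MvPolynomial.X i, by simp⟩
  have hxR (i : σ) : x i ∈ R := by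
    rw [← ht, Finset.sum_apply]
    refine sum_mem fun j _ => mul_mem (Algebra.subset_adjoin ⟨j, rfl⟩) (hcoord _ ?_)
    exact ⟨_, rfl⟩
  have hxhR : Algebra.adjoin k (Set.range x ∪ Set.range h) ≤ R.restrictScalars k := by
    rw [Algebra.adjoin_le_iff]
    rintro _ (⟨i, rfl⟩ | ⟨i, rfl⟩)
    exacts [hxR i, hhR i]
  have hmemR (a : K) (ha : a ∈ R) : a ∈ Subalgebra.algebraicClosure R K :=
    isAlgebraic_algebraMap (⟨a, ha⟩ : R)
  -- `s j` is a quotient of elements of `k[x, h]`, which is contained in `R`.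
  have hsR (j) : s j ∈ Subalgebra.algebraicClosure R K := by
    obtain ⟨a, ha, b, hb, hab⟩ :=
      IntermediateField.mem_adjoin_iff_div.1 (coeff_mem_adjoin hpl hh j)
    rw [hab, div_eq_mul_inv]
    exact mul_mem (hmemR a (hxhR ha)) (IsAlgebraic.inv (hmemR b (hxhR hb)))
  have hle : ∀ a ∈ Algebra.adjoin (coordRing k x) (Set.range s),
      a ∈ Subalgebra.algebraicClosure R K := by
    intro a ha
    induction ha using Algebra.adjoin_induction with
    | mem a ha =>
      obtain ⟨j, rfl⟩ := ha
      exact hsR j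
    | algebraMap a =>
      refine hmemR _ (hxhR (Algebra.adjoin_mono Set.subset_union_left ?_))
      rw [Algebra.adjoin_range_eq_range_aeval]
      exact a.2
    | add a b _ _ ha hb => exact add_mem ha hb
    | mul a b _ _ ha hb => exact mul_mem ha hb
  have halg := hs.isAlgebraic
  have : Algebra.IsAlgebraic R K := by
    refine ⟨fun z => ?_⟩
    have hsub (a : Algebra.adjoin (coordRing k x) (Set.range s)) :
        ∃ b : Subalgebra.algebraicClosure R K,
          algebraMap (Subalgebra.algebraicClosure R K) K b =
            algebraMap (Algebra.adjoin (coordRing k x) (Set.range s)) K a :=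
      ⟨⟨a, hle a a.2⟩, rfl⟩
    have hz : IsAlgebraic (Subalgebra.algebraicClosure R K) z :=
      isAlgebraic_of_range_subset hsub (halg.isAlgebraic z)
    exact hz.restrictScalars R
  apply Algebra.IsAlgebraic.isTranscendenceBasis_of_lift_le_trdeg_of_finite
  rw [Cardinal.mk_fin, Cardinal.lift_natCast, Cardinal.lift_uzero]
  have h2 := trdeg_coordRing_add (k := k) h
  rw [htr, ← finrank_conormalSpace_add_finrank_tangentSpace (idealAt k h) h, Nat.cast_add,
    ← finrank_tangentSpace_idealAt] at h2
  exact (Cardinal.eq_of_add_eq_add_left (h2.trans (add_comm _ _)) (Cardinal.natCast_lt_aleph0)).ge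

end Generic

/-! ### Polynomials restricted to combinations of gradients. -/

section Substitution

variable {k κ σ ι : Type*} [Field k] [Field κ] [Algebra k κ] [Fintype ι]

/-- Substitution of the combination of the gradients of the `p j` with indeterminate coefficients
for the second group of variables. -/
noncomputable def conormalSubst (p : ι → MvPolynomial σ k) :
    MvPolynomial (σ ⊕ σ) k →ₐ[k] MvPolynomial ι (MvPolynomial σ k) :=
  MvPolynomial.aeval (Sum.elim (fun i => MvPolynomial.C (MvPolynomial.X i))
    fun i => ∑ j, MvPolynomial.X j * MvPolynomial.C (MvPolynomial.pderiv i (p j)))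

theorem eval_map_conormalSubst (p : ι → MvPolynomial σ k) (v : σ → κ) (c : ι → κ)
    (g : MvPolynomial (σ ⊕ σ) k) :
    MvPolynomial.eval c (MvPolynomial.map
      (MvPolynomial.aeval v : MvPolynomial σ k →ₐ[k] κ).toRingHom (conormalSubst p g)) =
      MvPolynomial.aeval (Sum.elim v (∑ j, c j • gradient v (p j))) g := by
  induction g using MvPolynomial.induction_on with
  | C a =>
    rw [MvPolynomial.aeval_C, ← MvPolynomial.algebraMap_eq, AlgHom.commutes,
      MvPolynomial.algebraMap_apply, MvPolynomial.map_C, MvPolynomial.eval_C]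
    exact AlgHom.commutes _ a
  | add p q hp hq => simp only [map_add, hp, hq]
  | mul_X p i hp =>
    rw [map_mul, map_mul, map_mul, map_mul, hp]
    congr 1
    rcases i with i | i
    · simp [conormalSubst]
    · simp only [conormalSubst, MvPolynomial.aeval_X, Sum.elim_inr, map_sum, map_mul,
        MvPolynomial.map_X, MvPolynomial.map_C, MvPolynomial.eval_X, MvPolynomial.eval_C,
        Finset.sum_apply, Pi.smul_apply, smul_eq_mul]
      rfl

theorem aeval_eq_zero_of_map_conormalSubst {p : ι → MvPolynomial σ k} {v : σ → κ}
    {g : MvPolynomial (σ ⊕ σ) k}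
    (h : MvPolynomial.map (MvPolynomial.aeval v : MvPolynomial σ k →ₐ[k] κ).toRingHom
      (conormalSubst p g) = 0) (c : ι → κ) :
    MvPolynomial.aeval (Sum.elim v (∑ j, c j • gradient v (p j))) g = 0 := by
  rw [← eval_map_conormalSubst, h, map_zero]

theorem map_conormalSubst_eq_zero [Infinite κ] {p : ι → MvPolynomial σ k} {v : σ → κ}
    {g : MvPolynomial (σ ⊕ σ) k}
    (h : ∀ c : ι → κ,
      MvPolynomial.aeval (Sum.elim v (∑ j, c j • gradient v (p j))) g = 0) :
    MvPolynomial.map (MvPolynomial.aeval v : MvPolynomial σ k →ₐ[k] κ).toRingHom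
      (conormalSubst p g) = 0 := by
  refine MvPolynomial.funext fun c => ?_
  rw [eval_map_conormalSubst, h, map_zero]

omit [Fintype ι] in
theorem map_eq_zero_iff_coeff_mem {p : MvPolynomial ι (MvPolynomial σ k)} {v : σ → κ} :
    MvPolynomial.map (MvPolynomial.aeval v : MvPolynomial σ k →ₐ[k] κ).toRingHom p = 0 ↔
      ∀ m, MvPolynomial.aeval v (p.coeff m) = 0 := by
  rw [MvPolynomial.ext_iff]
  simp only [MvPolynomial.coeff_map, MvPolynomial.coeff_zero]
  rfl

end Substitution

/-! ### Passing vanishing between generic and special conormal vectors. -/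

section Vanishing

variable {k K κ σ : Type*} [Field k] [Field K] [Algebra k K] [Field κ] [Algebra k κ] [Fintype σ]

omit [Fintype σ] in
-- The coefficients of `h` are algebraically independent over `k[x]`, so a relation that holds for
-- them holds for all coefficients.
theorem IsGenericConormal.aeval_eq_zero_iff {x h : σ → K} (H : IsGenericConormal k x h)
    (g : MvPolynomial (σ ⊕ σ) k) :
    MvPolynomial.aeval (Sum.elim x h) g = 0 ↔
      ∀ u ∈ conormalSpace (idealAt k x) x, MvPolynomial.aeval (Sum.elim x u) g = 0 := by
  obtain ⟨p, s, hp, -, hps, hs, hh⟩ := H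
  constructor
  · intro h0 u hu
    rw [← hps] at hu
    obtain ⟨c, rfl⟩ := (Submodule.mem_span_range_iff_exists_fun K).1 hu
    apply aeval_eq_zero_of_map_conormalSubst
    rw [hh, ← eval_map_conormalSubst] at h0
    let F : MvPolynomial _ (coordRing k x) := MvPolynomial.map
      (MvPolynomial.aeval x : MvPolynomial σ k →ₐ[k] K).rangeRestrict.toRingHom
      (conormalSubst p g)
    have hF : MvPolynomial.map (algebraMap (coordRing k x) K) F =
        MvPolynomial.map (MvPolynomial.aeval x : MvPolynomial σ k →ₐ[k] K).toRingHom
          (conormalSubst p g) := by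
      rw [MvPolynomial.map_map]
      rfl
    rw [← hF, MvPolynomial.eval_map] at h0
    have : F = 0 := hs.1 (by rw [map_zero]; exact h0)
    rw [← hF, this, map_zero]
  · intro h0
    exact h0 h (hps.le ((Submodule.mem_span_range_iff_exists_fun K).2 ⟨s, hh.symm⟩))

/-- Specialization from `x` to `v`, with no smoothness at `v`: write `u` through gradients of some
`p j` at `v`. The same combinations at `x` are conormal, so the coefficients of the substituted `g`
vanish at `x`, hence at `v`. -/
theorem aeval_eq_zero_of_mem_conormalSpace [Infinite K] {x : σ → K}
    {g : MvPolynomial (σ ⊕ σ) k}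
    (hg : ∀ u ∈ conormalSpace (idealAt k x) x, MvPolynomial.aeval (Sum.elim x u) g = 0)
    {v u : σ → κ} (hv : ∀ p ∈ idealAt k x, MvPolynomial.aeval v p = 0)
    (hu : u ∈ conormalSpace (idealAt k x) v) :
    MvPolynomial.aeval (Sum.elim v u) g = 0 := by
  obtain ⟨p, hp, -, hps⟩ := exists_gradient_basis (idealAt k x) v
  rw [← hps] at hu
  obtain ⟨c, rfl⟩ := (Submodule.mem_span_range_iff_exists_fun κ).1 hu
  apply aeval_eq_zero_of_map_conormalSubst
  rw [map_eq_zero_iff_coeff_mem]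
  intro m
  apply hv
  revert m
  refine map_eq_zero_iff_coeff_mem.1 (map_conormalSubst_eq_zero fun c => hg _ ?_)
  exact sum_mem fun j _ => Submodule.smul_mem _ _ (Submodule.subset_span ⟨_, hp j, rfl⟩)

/-- The opposite passage: the coefficients of the substituted `g` vanish on the dense set `D`, hence
at `x`. -/
theorem aeval_eq_zero_of_dense [Infinite κ] {x : σ → K} {D : Set (σ → κ)}
    (hD : ∀ c : MvPolynomial σ k, (∀ v ∈ D, MvPolynomial.aeval v c = 0) → c ∈ idealAt k x)
    {g : MvPolynomial (σ ⊕ σ) k}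
    (hg : ∀ v ∈ D, ∀ u ∈ conormalSpace (idealAt k x) v, MvPolynomial.aeval (Sum.elim v u) g = 0)
    {u : σ → K} (hu : u ∈ conormalSpace (idealAt k x) x) :
    MvPolynomial.aeval (Sum.elim x u) g = 0 := by
  obtain ⟨p, hp, -, hps⟩ := exists_gradient_basis (idealAt k x) x
  rw [← hps] at hu
  obtain ⟨c, rfl⟩ := (Submodule.mem_span_range_iff_exists_fun K).1 hu
  apply aeval_eq_zero_of_map_conormalSubst
  rw [map_eq_zero_iff_coeff_mem]
  intro m
  refine hD _ fun v hv => ?_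
  revert m
  refine map_eq_zero_iff_coeff_mem.1 (map_conormalSubst_eq_zero fun c => hg v hv _ ?_)
  exact sum_mem fun j _ => Submodule.smul_mem _ _ (Submodule.subset_span ⟨_, hp j, rfl⟩)

end Vanishing

/-! ### Construction of a generic conormal vector. -/

section Existence

theorem exists_isGenericConormal {k σ : Type} [Field k] [CharZero k] [Fintype σ]
    (I : Ideal (MvPolynomial σ k)) [I.IsPrime] :
    ∃ (K : Type) (_ : Field K) (_ : Algebra k K) (_ : Algebra.EssFiniteType k K) (x h : σ → K),
      idealAt k x = I ∧ IsGenericConormal k x h := by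
  let A := MvPolynomial σ k ⧸ I
  have hA : Algebra.trdeg k A < Cardinal.aleph0 := trdeg_lt_aleph0_of_finiteType
  obtain ⟨t, ht⟩ := Cardinal.lt_aleph0.1 hA
  -- The codimension of the locus of `I`; it turns out to be the dimension of the conormal space at
  -- `x`, so the indeterminates of `B` serve as coefficients.
  let m := Fintype.card σ - t
  let B := MvPolynomial (Fin m) A
  let K := FractionRing B
  have : Algebra.EssFiniteType B K := .of_isLocalization _ (nonZeroDivisors B)
  have : Algebra.EssFiniteType A K := .comp A B K
  have : Algebra.EssFiniteType k K := .comp k A K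
  let x : σ → K := fun i => algebraMap A K (Ideal.Quotient.mk I (MvPolynomial.X i))
  have hAK : Function.Injective (algebraMap A K) := FaithfulSMul.algebraMap_injective A K
  have hx (p : MvPolynomial σ k) :
      MvPolynomial.aeval x p = algebraMap A K (Ideal.Quotient.mk I p) := by
    rw [show x = fun i => algebraMap A K (Ideal.Quotient.mk I (MvPolynomial.X i)) from rfl,
      aeval_algebraMap_fun]
    congr 1
    have : (MvPolynomial.aeval fun i => Ideal.Quotient.mk I (MvPolynomial.X i) :
        MvPolynomial σ k →ₐ[k] A) = Ideal.Quotient.mkₐ k I := by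
      ext i
      simp only [MvPolynomial.aeval_X]
      rfl
    rw [this]
    rfl
  have hI : idealAt k x = I := by
    ext p
    rw [RingHom.mem_ker, hx, map_eq_zero_iff _ hAK, Ideal.Quotient.eq_zero_iff_mem]
  let e : A ≃ₐ[k] coordRing k x :=
    (Ideal.quotientEquivAlgOfEq k hI.symm).trans
      (Ideal.quotientKerEquivRange (MvPolynomial.aeval x : MvPolynomial σ k →ₐ[k] K))
  have he (a : A) : ((e a : coordRing k x) : K) = algebraMap A K a := by
    obtain ⟨p, rfl⟩ := Ideal.Quotient.mk_surjective a
    rw [← hx]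
    rfl
  have htr : Algebra.trdeg k (coordRing k x) = t := by rw [← e.trdeg_eq, ht]
  have hfin := finrank_tangentSpace_idealAt (k := k) x
  rw [htr, Nat.cast_inj] at hfin
  have hcard := finrank_conormalSpace_add_finrank_tangentSpace (idealAt k x) x
  rw [hfin] at hcard
  have hm : Module.finrank K (conormalSpace (idealAt k x) x) = m := by
    simp only [m]
    omega
  let s : Fin (Module.finrank K (conormalSpace (idealAt k x) x)) → K :=
    fun i => algebraMap B K (MvPolynomial.X (Fin.cast hm i))
  have hs : IsTranscendenceBasis (coordRing k x) s := by
    have h1 : AlgebraicIndependent A s :=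
      ((MvPolynomial.algebraicIndependent_X (Fin m) A).comp _ (Fin.cast_injective hm)).map'
        (f := IsScalarTower.toAlgHom A B K) (IsFractionRing.injective B K)
    have h2 : AlgebraicIndependent (coordRing k x) s :=
      AlgebraicIndependent.of_ringHom_of_comp_eq (S := A) (R := coordRing k x)
        (f := e.symm.toRingEquiv.toRingHom) (g := RingHom.id K) h1 e.symm.injective (by
          ext a
          change algebraMap A K (e.symm a) = _
          rw [← he, e.apply_symm_apply]
          rfl)
    apply h2.isTranscendenceBasis_of_trdeg_le_of_finite
    rw [Cardinal.mk_fin, hm]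
    have halg : Algebra.IsAlgebraic B K :=
      IsFractionRing.comap_isAlgebraic_iff.mpr (inferInstance : Algebra.IsAlgebraic K K)
    have h3 := trdeg_add_eq A B (A := K)
    rw [trdeg_eq_zero (R := B), add_zero, MvPolynomial.trdeg_of_isDomain,
      Cardinal.mk_fin, Cardinal.lift_natCast] at h3
    have h4 := trdeg_add_eq k A (A := K)
    have h5 := trdeg_coordRing_add (k := k) x
    rw [← h4, htr, ht] at h5
    rw [h3]
    exact (Cardinal.eq_of_add_eq_add_left h5 Cardinal.natCast_lt_aleph0).le
  obtain ⟨p, hp, hpl, hps⟩ := exists_gradient_basis (idealAt k x) x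
  exact ⟨K, inferInstance, inferInstance, inferInstance, x, _, hI, p, s, hp, hpl, hps, hs, rfl⟩

end Existence

/-! ### Equations for conormal vectors where the Jacobian rank is generic. -/

section Determinantal

variable {k L σ m : Type*} [Field k] [Field L] [Algebra k L] [Fintype σ]

/-- The matrix whose rows are the gradients at `a` of the `p j`. -/
noncomputable def gradientMatrix (p : m → MvPolynomial σ k) (a : σ → L) : Matrix m σ L :=
  Matrix.of fun j => gradient a (p j)

/-- The matrix of the partial derivatives of the `p j`. -/
noncomputable def jacobianMatrix (p : m → MvPolynomial σ k) : Matrix m σ (MvPolynomial σ k) :=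
  Matrix.of fun j i => MvPolynomial.pderiv i (p j)

omit [Fintype σ] in
theorem sum_smul_gradient [Fintype m] (p : m → MvPolynomial σ k) (a : σ → L) (c : m → L) :
    ∑ j, c j • gradient a (p j) = Matrix.vecMul c (gradientMatrix p a) := by
  ext i
  simp [Matrix.vecMul, dotProduct, gradientMatrix]

theorem aeval_det_jacobianMatrix [Fintype m] [DecidableEq m] (p : m → MvPolynomial σ k)
    (C : Matrix σ m k) (a : σ → L) :
    MvPolynomial.aeval a (jacobianMatrix p *
        (C.map MvPolynomial.C : Matrix σ m (MvPolynomial σ k))).det =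
      (gradientMatrix p a * C.map (algebraMap k L)).det := by
  set φ : MvPolynomial σ k →+* L := (MvPolynomial.aeval a : MvPolynomial σ k →ₐ[k] L).toRingHom
  change φ _ = _
  rw [RingHom.map_det, RingHom.mapMatrix_apply, Matrix.map_mul]
  congr 2
  ext i j
  exact MvPolynomial.aeval_C _ _

/-- Polynomials in a point and a vector which express, where a minor of the Jacobian matrix does
not vanish, that the vector is a combination of gradients. -/
noncomputable def rowSpaceEquation [Fintype m] [DecidableEq m] (p : m → MvPolynomial σ k)
    (C : Matrix σ m k) (i : σ) : MvPolynomial (σ ⊕ σ) k :=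
  let M : Matrix m σ (MvPolynomial (σ ⊕ σ) k) :=
    (jacobianMatrix p).map (MvPolynomial.rename Sum.inl)
  let Q : Matrix m m (MvPolynomial (σ ⊕ σ) k) :=
    M * (C.map MvPolynomial.C : Matrix σ m (MvPolynomial (σ ⊕ σ) k))
  Q.det * MvPolynomial.X (Sum.inr i) -
    Matrix.vecMul (Matrix.vecMul
      (Matrix.vecMul (fun j => MvPolynomial.X (Sum.inr j)) (C.map MvPolynomial.C))
      Q.adjugate) M i

theorem aeval_rowSpaceEquation [Fintype m] [DecidableEq m] (p : m → MvPolynomial σ k)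
    (C : Matrix σ m k) (a b : σ → L) (i : σ) :
    MvPolynomial.aeval (Sum.elim a b) (rowSpaceEquation p C i) =
      (gradientMatrix p a * C.map (algebraMap k L)).det * b i -
        Matrix.vecMul (Matrix.vecMul (Matrix.vecMul b (C.map (algebraMap k L)))
          (gradientMatrix p a * C.map (algebraMap k L)).adjugate) (gradientMatrix p a) i := by
  set φ : MvPolynomial (σ ⊕ σ) k →+* L :=
    (MvPolynomial.aeval (Sum.elim a b) : MvPolynomial (σ ⊕ σ) k →ₐ[k] L).toRingHom
  have hM : ((jacobianMatrix p).map (MvPolynomial.rename Sum.inl)).map φ = gradientMatrix p a := by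
    ext j i
    change MvPolynomial.aeval (Sum.elim a b) (MvPolynomial.rename Sum.inl _) = _
    rw [MvPolynomial.aeval_rename, Sum.elim_comp_inl]
    rfl
  have hC : (C.map MvPolynomial.C).map φ = C.map (algebraMap k L) := by
    ext i j
    exact MvPolynomial.aeval_C _ _
  have hY : b = φ ∘ fun j => MvPolynomial.X (Sum.inr j) := by
    ext i
    simp [φ]
  change φ _ = _
  rw [rowSpaceEquation, map_sub, map_mul, RingHom.map_vecMul, RingHom.map_det,
    RingHom.mapMatrix_apply, Matrix.map_mul, hM, hC]
  congr 2
  · simp [φ]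
  · ext j
    rw [Function.comp_apply, RingHom.map_vecMul, ← RingHom.mapMatrix_apply, RingHom.map_adjugate,
      RingHom.mapMatrix_apply, Matrix.map_mul, hM, hC]
    congr 2
    ext j
    rw [Function.comp_apply, RingHom.map_vecMul, hC, ← hY]

/-- A basis of gradients at `v` has a minor equal to `1` there (up to a change of columns by `C`),
so the minor is nonzero at `x`. By equality of ranks the same polynomials give a basis at `x`, and
the row space equations, valid at `x`, force `u` into the row space at `v`. -/
theorem mem_conormalSpace_of_forall_aeval_eq_zero {K : Type*} [Field K] [Algebra k K]
    {x : σ → K} {v u : σ → k}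
    (hv : ∀ p ∈ idealAt k x, MvPolynomial.aeval v p = 0)
    (hr : Module.finrank k (conormalSpace (idealAt k x) v) =
      Module.finrank K (conormalSpace (idealAt k x) x))
    (h : ∀ g : MvPolynomial (σ ⊕ σ) k,
      (∀ w ∈ conormalSpace (idealAt k x) x, MvPolynomial.aeval (Sum.elim x w) g = 0) →
        MvPolynomial.aeval (Sum.elim v u) g = 0) :
    u ∈ conormalSpace (idealAt k x) v := by
  obtain ⟨p, hp, hpl, hps⟩ := exists_gradient_basis (idealAt k x) v
  obtain ⟨C, hC⟩ := exists_matrix_rightInverse (gradientMatrix p v) hpl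
  have hC1 : gradientMatrix p v * C.map (algebraMap k k) = 1 := hC
  have hD0 : (gradientMatrix p x * C.map (algebraMap k K)).det ≠ 0 := by
    rw [← aeval_det_jacobianMatrix]
    intro h0
    have h1 := hv _ h0
    rw [aeval_det_jacobianMatrix, hC1, Matrix.det_one] at h1
    exact one_ne_zero h1
  have hxl : LinearIndependent K fun j => gradient x (p j) := by
    have : Function.Injective fun c => Matrix.vecMul c (gradientMatrix p x) := by
      intro c d hcd
      have h1 := congrArg (fun w => Matrix.vecMul w (C.map (algebraMap k K))) hcd
      simp only [Matrix.vecMul_vecMul] at h1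
      exact Matrix.vecMul_injective_of_isUnit
        ((Matrix.isUnit_iff_isUnit_det _).2 hD0.isUnit) h1
    exact Matrix.vecMul_injective_iff.1 this
  have hxs : Submodule.span K (Set.range fun j => gradient x (p j)) =
      conormalSpace (idealAt k x) x := by
    apply Submodule.eq_of_le_of_finrank_eq
    · rw [Submodule.span_le]
      rintro _ ⟨j, rfl⟩
      exact Submodule.subset_span ⟨_, hp j, rfl⟩
    · rw [finrank_span_eq_card hxl, Fintype.card_fin, hr]
  have hg (i : σ) : MvPolynomial.aeval (Sum.elim v u) (rowSpaceEquation p C i) = 0 := by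
    apply h
    intro w hw
    rw [← hxs] at hw
    obtain ⟨c, rfl⟩ := (Submodule.mem_span_range_iff_exists_fun K).1 hw
    rw [aeval_rowSpaceEquation, sum_smul_gradient, Matrix.vecMul_vecMul c, Matrix.vecMul_vecMul c,
      Matrix.mul_adjugate, Matrix.vecMul_smul, Matrix.vecMul_one, Matrix.smul_vecMul,
      Pi.smul_apply, smul_eq_mul, sub_self]
  have hu : Matrix.vecMul (Matrix.vecMul u C) (gradientMatrix p v) = u := by
    ext i
    have h1 := hg i
    rw [aeval_rowSpaceEquation, hC1, Matrix.det_one, one_mul, Matrix.adjugate_one,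
      Matrix.vecMul_one, sub_eq_zero] at h1
    exact h1.symm
  rw [← hu, ← sum_smul_gradient]
  exact sum_mem fun j _ => Submodule.smul_mem _ _ (Submodule.subset_span ⟨_, hp j, rfl⟩)

end Determinantal

/-! ### The affine cone, its ideal and the Zariski closure. -/

section Cone

variable {n : ℕ}

theorem eval_smul_of_isHomogeneous {k σ : Type*} [Field k] [Fintype σ] {p : MvPolynomial σ k}
    {d : ℕ} (hp : p.IsHomogeneous d) (c : k) (v : σ → k) :
    MvPolynomial.eval (c • v) p = c ^ d * MvPolynomial.eval v p := by
  rw [MvPolynomial.eval_eq', MvPolynomial.eval_eq', Finset.mul_sum]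
  refine Finset.sum_congr rfl fun m hm => ?_
  have hd : ∑ i, m i = d := by
    rw [← hp (MvPolynomial.mem_support_iff.1 hm), Finsupp.weight_apply,
      Finsupp.sum_fintype _ _ (by simp)]
    simp
  simp only [Pi.smul_apply, smul_eq_mul, mul_pow, Finset.prod_mul_distrib,
    Finset.prod_pow_eq_pow_sum, hd]
  ring

theorem mem_coneIdeal {X : Set (ProjSpace n)} {p : MvPolynomial (Fin (n + 1)) ℂ} :
    p ∈ coneIdeal X ↔ ∀ v ∈ cone X, MvPolynomial.eval v p = 0 := Iff.rfl

theorem zero_mem_cone (X : Set (ProjSpace n)) : (0 : Fin (n + 1) → ℂ) ∈ cone X :=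
  fun h => (h rfl).elim

theorem rep_mem_cone {X : Set (ProjSpace n)} {x : ProjSpace n} (hx : x ∈ X) : x.rep ∈ cone X :=
  fun h => by rwa [Projectivization.mk_rep]

theorem smul_mem_cone {X : Set (ProjSpace n)} {v : Fin (n + 1) → ℂ} (hv : v ∈ cone X) (c : ℂ) :
    c • v ∈ cone X := by
  intro h
  have hv0 : v ≠ 0 := fun h0 => h (by rw [h0, smul_zero])
  have hc : c ≠ 0 := fun h0 => h (by rw [h0, zero_smul])
  have : Projectivization.mk ℂ (c • v) h = Projectivization.mk ℂ v hv0 :=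
    (Projectivization.mk_eq_mk_iff' ℂ _ _ _ _).2 ⟨c, rfl⟩
  rw [this]
  exact hv hv0

theorem exists_rep_eq_smul {v : Fin (n + 1) → ℂ} (hv : v ≠ 0) :
    ∃ a : ℂ, a ≠ 0 ∧ (Projectivization.mk ℂ v hv).rep = a • v := by
  obtain ⟨a, ha⟩ := Projectivization.exists_smul_eq_mk_rep ℂ v hv
  exact ⟨a, a.ne_zero, ha.symm⟩

theorem cone_mono {X Y : Set (ProjSpace n)} (h : X ⊆ Y) : cone X ⊆ cone Y :=
  fun _ hv hv0 => h (hv hv0)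

/-- Along a line of the cone `p` is a polynomial in the scaling parameter, vanishing identically;
its coefficients are the values of the components. -/
theorem homogeneousComponent_mem_coneIdeal {X : Set (ProjSpace n)}
    {p : MvPolynomial (Fin (n + 1)) ℂ} (hp : p ∈ coneIdeal X) (d : ℕ) :
    MvPolynomial.homogeneousComponent d p ∈ coneIdeal X := by
  rw [mem_coneIdeal] at hp ⊢
  intro v hv
  let f : Polynomial ℂ := ∑ e ∈ Finset.range (p.totalDegree + 1),
    Polynomial.monomial e (MvPolynomial.eval v (MvPolynomial.homogeneousComponent e p))
  have hf : f = 0 := by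
    refine Polynomial.funext fun c => ?_
    have h1 := hp (c • v) (smul_mem_cone hv c)
    rw [← MvPolynomial.sum_homogeneousComponent p, map_sum] at h1
    rw [Polynomial.eval_zero, ← h1, Polynomial.eval_finsetSum]
    refine Finset.sum_congr rfl fun e _ => ?_
    rw [Polynomial.eval_monomial, eval_smul_of_isHomogeneous
      (MvPolynomial.homogeneousComponent_isHomogeneous e p), mul_comm]
  by_cases hd : d < p.totalDegree + 1
  · have := congrArg (fun g => Polynomial.coeff g d) hf
    simpa [f, Polynomial.finsetSum_coeff, Polynomial.coeff_monomial, hd] using this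
  · rw [MvPolynomial.homogeneousComponent_eq_zero _ _ (by omega), map_zero]

theorem isClosed_iff_isAlgebraicSet {X : Set (ProjSpace n)} : IsClosed X ↔ IsAlgebraicSet X := by
  rw [← isOpen_compl_iff]
  change Xᶜᶜ ∈ {X | IsAlgebraicSet X} ↔ _
  rw [compl_compl]
  rfl

/-- Nonemptiness deals with the vertex: `0` always lies on the cone, and for empty `X` a nonzero
constant would be a counterexample. -/
theorem mem_coneIdeal_of_isHomogeneous {X : Set (ProjSpace n)} (hX : X.Nonempty)
    {p : MvPolynomial (Fin (n + 1)) ℂ} {d : ℕ} (hp : p.IsHomogeneous d)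
    (h : ∀ x ∈ X, MvPolynomial.eval x.rep p = 0) : p ∈ coneIdeal X := by
  rw [mem_coneIdeal]
  intro v hv
  by_cases hv0 : v = 0
  · obtain ⟨x, hx⟩ := hX
    rw [hv0, ← zero_smul ℂ x.rep, eval_smul_of_isHomogeneous hp, h x hx, mul_zero]
  · obtain ⟨a, ha, hav⟩ := exists_rep_eq_smul hv0
    have h1 := h _ (hv hv0)
    rw [hav, eval_smul_of_isHomogeneous hp] at h1
    exact (mul_eq_zero.1 h1).resolve_left (pow_ne_zero _ ha)

theorem isClosed_projZeroLocus {S : Set (MvPolynomial (Fin (n + 1)) ℂ)}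
    (hS : ∀ p ∈ S, ∃ d : ℕ, p.IsHomogeneous d) : IsClosed (projZeroLocus S) :=
  isClosed_iff_isAlgebraicSet.2 ⟨S, hS, rfl⟩

theorem mem_closure_iff {X : Set (ProjSpace n)} (hX : X.Nonempty) {x : ProjSpace n} :
    x ∈ closure X ↔ ∀ p ∈ coneIdeal X, MvPolynomial.eval x.rep p = 0 := by
  constructor
  · intro hx p hp
    rw [← MvPolynomial.sum_homogeneousComponent p, map_sum]
    refine Finset.sum_eq_zero fun d _ => ?_
    have hcl : IsClosed (projZeroLocus {MvPolynomial.homogeneousComponent d p}) :=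
      isClosed_projZeroLocus fun q hq => ⟨d, by
        rw [Set.mem_singleton_iff.1 hq]
        exact MvPolynomial.homogeneousComponent_isHomogeneous d p⟩
    have hsub : X ⊆ projZeroLocus {MvPolynomial.homogeneousComponent d p} := by
      rintro y hy q rfl
      exact homogeneousComponent_mem_coneIdeal hp d _ (rep_mem_cone hy)
    exact closure_minimal hsub hcl hx _ rfl
  · intro h
    rintro Z ⟨hZ, hXZ⟩
    obtain ⟨S, hS, rfl⟩ := isClosed_iff_isAlgebraicSet.1 hZ
    intro p hp
    obtain ⟨d, hd⟩ := hS p hp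
    exact h p (mem_coneIdeal_of_isHomogeneous hX hd fun y hy => hXZ hy p hp)

theorem coneIdeal_closure {X : Set (ProjSpace n)} (hX : X.Nonempty) :
    coneIdeal (closure X) = coneIdeal X := by
  apply le_antisymm
  · exact MvPolynomial.vanishingIdeal_anti_mono (cone_mono subset_closure)
  · intro p hp
    rw [← MvPolynomial.sum_homogeneousComponent p]
    refine sum_mem fun d _ => ?_
    refine mem_coneIdeal_of_isHomogeneous hX.closure
      (MvPolynomial.homogeneousComponent_isHomogeneous d p) fun x hx => ?_
    exact (mem_closure_iff hX).1 hx _ (homogeneousComponent_mem_coneIdeal hp d)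

theorem mem_iff_of_isClosed {X : Set (ProjSpace n)} (hX : X.Nonempty) (hc : IsClosed X)
    {x : ProjSpace n} : x ∈ X ↔ ∀ p ∈ coneIdeal X, MvPolynomial.eval x.rep p = 0 := by
  rw [← mem_closure_iff hX, hc.closure_eq]

theorem one_notMem_coneIdeal (X : Set (ProjSpace n)) : (1 : MvPolynomial _ ℂ) ∉ coneIdeal X := by
  intro h
  have := h 0 (zero_mem_cone X)
  simp at this

attribute [local instance] MvPolynomial.gradedAlgebra in
-- The ideal is homogeneous, so primality may be tested on homogeneous factors; these cut out two
-- closed sets covering `X`.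
theorem coneIdeal_isPrime {X : Set (ProjSpace n)} (hX : IsIrreducible X) :
    (coneIdeal X).IsPrime := by
  have hh : Ideal.IsHomogeneous (MvPolynomial.homogeneousSubmodule (Fin (n + 1)) ℂ)
      (coneIdeal X) := by
    intro d p hp
    have hd := MvPolynomial.decomposition.decompose'_apply p d
    change ((DirectSum.decompose (MvPolynomial.homogeneousSubmodule (Fin (n + 1)) ℂ) p) d :
      MvPolynomial (Fin (n + 1)) ℂ) = _ at hd
    rw [hd]
    exact homogeneousComponent_mem_coneIdeal hp d
  refine hh.isPrime_of_homogeneous_mem_or_mem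
    ((Ideal.ne_top_iff_one _).2 (one_notMem_coneIdeal X)) ?_
  rintro p q ⟨d, hd⟩ ⟨e, he⟩ hpq
  rw [MvPolynomial.mem_homogeneousSubmodule] at hd he
  have hsub : X ⊆ projZeroLocus {p} ∪ projZeroLocus {q} := by
    intro x hx
    have := hpq _ (rep_mem_cone hx)
    rw [map_mul, mul_eq_zero] at this
    refine this.imp ?_ ?_ <;>
    · rintro h _ rfl
      exact h
  have := isPreirreducible_iff_isClosed_union_isClosed.1 hX.2 _ _
    (isClosed_projZeroLocus fun r hr => ⟨d, by rwa [Set.mem_singleton_iff.1 hr]⟩)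
    (isClosed_projZeroLocus fun r hr => ⟨e, by rwa [Set.mem_singleton_iff.1 hr]⟩) hsub
  exact this.imp
    (fun h => mem_coneIdeal_of_isHomogeneous hX.1 hd fun x hx => h hx p rfl)
    (fun h => mem_coneIdeal_of_isHomogeneous hX.1 he fun x hx => h hx q rfl)

theorem euler_mem_coneIdeal {X : Set (ProjSpace n)} {p : MvPolynomial (Fin (n + 1)) ℂ}
    (hp : p ∈ coneIdeal X) :
    ∑ i, MvPolynomial.X i * MvPolynomial.pderiv i p ∈ coneIdeal X := by
  rw [← MvPolynomial.sum_homogeneousComponent p]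
  simp only [map_sum, Finset.mul_sum]
  rw [Finset.sum_comm]
  refine sum_mem fun d _ => ?_
  rw [(MvPolynomial.homogeneousComponent_isHomogeneous d p).sum_X_mul_pderiv]
  exact nsmul_mem (homogeneousComponent_mem_coneIdeal hp d) d

/-- Rescaling of the variables. -/
noncomputable def scale (b : ℂ) :
    MvPolynomial (Fin (n + 1)) ℂ →ₐ[ℂ] MvPolynomial (Fin (n + 1)) ℂ :=
  MvPolynomial.aeval fun i => MvPolynomial.C b * MvPolynomial.X i

theorem aeval_scale {κ : Type*} [Field κ] [Algebra ℂ κ] (b : ℂ) (v : Fin (n + 1) → κ)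
    (p : MvPolynomial (Fin (n + 1)) ℂ) :
    MvPolynomial.aeval v (scale b p) = MvPolynomial.aeval (b • v) p := by
  rw [scale, ← AlgHom.comp_apply, MvPolynomial.comp_aeval]
  congr 2
  ext i
  simp [Algebra.smul_def]

theorem scale_mem_coneIdeal {X : Set (ProjSpace n)} {p : MvPolynomial (Fin (n + 1)) ℂ}
    (hp : p ∈ coneIdeal X) (b : ℂ) : scale b p ∈ coneIdeal X := by
  intro v hv
  rw [aeval_scale]
  exact hp _ (smul_mem_cone hv b)

theorem gradient_scale (b : ℂ) (v : Fin (n + 1) → ℂ) (p : MvPolynomial (Fin (n + 1)) ℂ) :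
    gradient v (scale b p) = b • gradient (b • v) p := by
  ext i
  simp only [gradient, Pi.smul_apply, smul_eq_mul]
  rw [scale, derivation_aeval (MvPolynomial.pderiv i), map_sum, Finset.sum_eq_single i]
  · rw [smul_eq_mul, map_mul, mul_comm]
    congr 1
    · simp [Derivation.leibniz]
    · exact aeval_scale b v _
  · intro j _ hj
    simp [Derivation.leibniz, MvPolynomial.pderiv_X_of_ne hj]
  · simp

theorem conormalSpace_smul {X : Set (ProjSpace n)} {b : ℂ} (hb : b ≠ 0) (v : Fin (n + 1) → ℂ) :
    conormalSpace (coneIdeal X) (b • v) = conormalSpace (coneIdeal X) v := by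
  have key (b : ℂ) (hb : b ≠ 0) (v : Fin (n + 1) → ℂ) :
      conormalSpace (coneIdeal X) (b • v) ≤ conormalSpace (coneIdeal X) v := by
    rw [conormalSpace, Submodule.span_le]
    rintro _ ⟨p, hp, rfl⟩
    have : gradient (b • v) p = b⁻¹ • gradient v (scale b p) := by
      rw [gradient_scale, smul_smul, inv_mul_cancel₀ hb, one_smul]
    rw [this]
    exact Submodule.smul_mem _ _ (Submodule.subset_span ⟨_, scale_mem_coneIdeal hp b, rfl⟩)
  refine le_antisymm (key b hb v) ?_
  have := key b⁻¹ (inv_ne_zero hb) (b • v)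
  rwa [smul_smul, inv_mul_cancel₀ hb, one_smul] at this

end Cone

/-! ### Smooth points: constancy of the tangent dimension, density. -/

section Smooth

theorem exists_basis_kaehlerDifferential_of_isLocalRing (k B : Type*) [CommRing k] [CommRing B]
    [IsLocalRing B] [Algebra k B] [Algebra.EssFiniteType k B] [Algebra.FormallySmooth k B] :
    ∃ d : ℕ, Nonempty (Module.Basis (Fin d) B Ω[B⁄k]) := by
  have : Module.Free B Ω[B⁄k] := Module.free_of_flat_of_isLocalRing
  exact ⟨_, ⟨Module.finBasis B Ω[B⁄k]⟩⟩

theorem finrank_tangentSpace_of_basis_localization {k A B ι κ σ : Type*} [Field k] [Fintype σ]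
    [CommRing A] [Algebra k A] [CommRing B] [Algebra k B] [Algebra A B] [IsScalarTower k A B]
    [Fintype ι] (M : Submonoid A) [IsLocalization M B] (b : Module.Basis ι B Ω[B⁄k]) (a : σ → A)
    (ha : Function.Surjective (MvPolynomial.aeval a : MvPolynomial σ k →ₐ[k] A))
    [Field κ] [Algebra k κ] (φ : A →ₐ[k] κ) (hφ : ∀ y ∈ M, φ y ≠ 0) :
    Module.finrank κ
      (tangentSpace (RingHom.ker (MvPolynomial.aeval a : MvPolynomial σ k →ₐ[k] A))
        (fun i => φ (a i))) = Fintype.card ι := by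
  let _ : Algebra A κ := φ.toRingHom.toAlgebra
  have hunit (y : M) : IsUnit (φ.toRingHom y) := (hφ y y.2).isUnit
  let _ : Algebra B κ := (IsLocalization.lift hunit).toAlgebra
  have : IsScalarTower A B κ := .of_algebraMap_eq fun a =>
    (IsLocalization.lift_eq hunit a).symm
  have : IsScalarTower k A κ := .of_algebraMap_eq fun r => (φ.commutes r).symm
  have : IsScalarTower k B κ := .of_algebraMap_eq fun r => by
    rw [IsScalarTower.algebraMap_apply k A B, ← IsScalarTower.algebraMap_apply A B κ,
      ← IsScalarTower.algebraMap_apply k A κ]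
  have : Algebra.FormallyEtale A B := .of_isLocalization M
  exact finrank_tangentSpace b a ha

/-- The differentials of the smooth local ring at `P` are free, and `d` is their rank. Every `v`
whose evaluation factors through this local ring has tangent dimension `d`; both the closed point
`P` and the generic point qualify. -/
theorem exists_finrank_tangentSpace_eq {k σ : Type*} [Field k] [Fintype σ]
    (I : Ideal (MvPolynomial σ k)) (P : PrimeSpectrum (MvPolynomial σ k ⧸ I))
    (hP : P ∈ Algebra.smoothLocus k (MvPolynomial σ k ⧸ I)) :
    ∃ d : ℕ, ∀ (κ : Type) [Field κ] [Algebra k κ] (v : σ → κ),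
      (∀ p ∈ I, MvPolynomial.aeval v p = 0) →
      (∀ p : MvPolynomial σ k, MvPolynomial.aeval v p = 0 → Ideal.Quotient.mk I p ∈ P.asIdeal) →
      Module.finrank κ (tangentSpace I v) = d := by
  have : Algebra.FormallySmooth k (Localization.AtPrime P.asIdeal) := hP
  have : Algebra.EssFiniteType (MvPolynomial σ k ⧸ I) (Localization.AtPrime P.asIdeal) :=
    .of_isLocalization _ P.asIdeal.primeCompl
  have : Algebra.EssFiniteType k (Localization.AtPrime P.asIdeal) :=
    .comp k (MvPolynomial σ k ⧸ I) _
  obtain ⟨d, ⟨b⟩⟩ :=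
    exists_basis_kaehlerDifferential_of_isLocalRing k (Localization.AtPrime P.asIdeal)
  refine ⟨d, fun κ _ _ v hv hvP => ?_⟩
  have ha : (MvPolynomial.aeval fun i => Ideal.Quotient.mk I (MvPolynomial.X i) :
      MvPolynomial σ k →ₐ[k] MvPolynomial σ k ⧸ I) = Ideal.Quotient.mkₐ k I := by
    ext i
    simp only [MvPolynomial.aeval_X]
    rfl
  have h := finrank_tangentSpace_of_basis_localization P.asIdeal.primeCompl b
    (fun i => Ideal.Quotient.mk I (MvPolynomial.X i))
    (by rw [ha]; exact Ideal.Quotient.mk_surjective)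
    (Ideal.Quotient.liftₐ I (MvPolynomial.aeval v) hv) (by
      intro y hy h0
      obtain ⟨p, rfl⟩ := Ideal.Quotient.mk_surjective y
      exact hy (hvP p h0))
  rw [ha, Fintype.card_fin] at h
  have hker : RingHom.ker (Ideal.Quotient.mkₐ k I) = I := Ideal.Quotient.mkₐ_ker k I
  have hv' : (fun i => Ideal.Quotient.liftₐ I (MvPolynomial.aeval v) hv
      (Ideal.Quotient.mk I (MvPolynomial.X i))) = v :=
    funext fun i => MvPolynomial.aeval_X v i
  rwa [hker, hv'] at h

/-- The smooth locus is open and contains the generic point, the fraction field being formally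
smooth in characteristic zero. -/
theorem exists_smoothLocus_of_isDomain {k A : Type*} [Field k] [CharZero k] [CommRing A]
    [IsDomain A] [Algebra k A] [Algebra.FinitePresentation k A] :
    ∃ f : A, f ≠ 0 ∧ ∀ P : PrimeSpectrum A, f ∉ P.asIdeal → P ∈ Algebra.smoothLocus k A := by
  let P₀ : PrimeSpectrum A := ⟨⊥, Ideal.isPrime_bot⟩
  have hloc : IsLocalization.AtPrime (FractionRing A) P₀.asIdeal := by
    have : P₀.asIdeal.primeCompl = nonZeroDivisors A := by
      ext a
      simp [P₀, Ideal.primeCompl]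
    unfold IsLocalization.AtPrime
    rw [this]
    infer_instance
  have : Algebra.EssFiniteType A (FractionRing A) := .of_isLocalization _ (nonZeroDivisors A)
  have : Algebra.EssFiniteType k (FractionRing A) := .comp k A (FractionRing A)
  have h0 : P₀ ∈ Algebra.smoothLocus k A :=
    Algebra.FormallySmooth.of_equiv
      ((IsLocalization.algEquiv P₀.asIdeal.primeCompl (FractionRing A)
        (Localization.AtPrime P₀.asIdeal)).restrictScalars k)
  obtain ⟨_, ⟨_, ⟨f, rfl⟩, rfl⟩, hf0, hf⟩ :=
    PrimeSpectrum.isBasis_basic_opens.exists_subset_of_mem_open h0 Algebra.isOpen_smoothLocus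
  refine ⟨f, fun h => hf0 (by rw [h]; exact Ideal.zero_mem _), fun P hP => hf hP⟩

/-- Smoothness of the affine scheme defined by `I` at the point `v`. -/
def IsSmoothVector {σ : Type*} (I : Ideal (MvPolynomial σ ℂ)) (v : σ → ℂ) : Prop :=
  ∃ P ∈ Algebra.smoothLocus ℂ (MvPolynomial σ ℂ ⧸ I),
    P.asIdeal.comap (Ideal.Quotient.mk I) = MvPolynomial.vanishingIdeal ℂ {v}

theorem mem_smoothLocus_of_algEquiv {k A A' : Type*} [CommRing k] [CommRing A] [CommRing A']
    [Algebra k A] [Algebra k A'] (e : A ≃ₐ[k] A') {P : PrimeSpectrum A'}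
    (hP : PrimeSpectrum.comap (e : A →+* A') P ∈ Algebra.smoothLocus k A) :
    P ∈ Algebra.smoothLocus k A' := by
  have hs : Algebra.FormallySmooth k
    (Localization.AtPrime (PrimeSpectrum.comap (e : A →+* A') P).asIdeal) := hP
  have hmap : Submonoid.map e (PrimeSpectrum.comap (e : A →+* A') P).asIdeal.primeCompl =
      P.asIdeal.primeCompl := by
    ext a
    constructor
    · rintro ⟨b, hb, rfl⟩
      exact hb
    · intro ha
      refine ⟨e.symm a, ?_, e.apply_symm_apply a⟩
      intro h
      have h' : e (e.symm a) ∈ P.asIdeal := h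
      rw [e.apply_symm_apply] at h'
      exact ha h'
  exact Algebra.FormallySmooth.of_equiv (IsLocalization.algEquivOfAlgEquiv
    (Localization.AtPrime (PrimeSpectrum.comap (e : A →+* A') P).asIdeal)
    (Localization.AtPrime P.asIdeal) e hmap)

variable {n : ℕ}

theorem scale_scale_inv {b : ℂ} (hb : b ≠ 0) (p : MvPolynomial (Fin (n + 1)) ℂ) :
    scale b (scale b⁻¹ p) = p := by
  have : ((scale b).comp (scale b⁻¹) : MvPolynomial (Fin (n + 1)) ℂ →ₐ[ℂ] _) = AlgHom.id _ _ := by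
    ext1 i
    simp only [scale, AlgHom.comp_apply, MvPolynomial.aeval_X, map_mul, MvPolynomial.algHom_C,
      MvPolynomial.algebraMap_eq, AlgHom.id_apply]
    rw [← mul_assoc, ← map_mul, inv_mul_cancel₀ hb, map_one, one_mul]
  exact AlgHom.congr_fun this p

/-- Rescaling is an automorphism of the cone, so smoothness does not depend on the representative.
-/
theorem IsSmoothVector.smul {X : Set (ProjSpace n)} {v : Fin (n + 1) → ℂ}
    (h : IsSmoothVector (coneIdeal X) v) {b : ℂ} (hb : b ≠ 0) :
    IsSmoothVector (coneIdeal X) (b • v) := by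
  obtain ⟨P, hP, hPv⟩ := h
  have hinv (p : MvPolynomial (Fin (n + 1)) ℂ) : scale b⁻¹ (scale b p) = p := by
    have := scale_scale_inv (inv_ne_zero hb) p
    rwa [inv_inv] at this
  let e₀ : MvPolynomial (Fin (n + 1)) ℂ ≃ₐ[ℂ] MvPolynomial (Fin (n + 1)) ℂ :=
    AlgEquiv.ofAlgHom (scale b⁻¹) (scale b) (AlgHom.ext hinv)
      (AlgHom.ext fun p => scale_scale_inv hb p)
  have he₀ (p : MvPolynomial (Fin (n + 1)) ℂ) : e₀ (scale b p) = p := hinv p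
  have hI : coneIdeal X = (coneIdeal X).map
      (e₀ : MvPolynomial (Fin (n + 1)) ℂ →+* MvPolynomial (Fin (n + 1)) ℂ) := by
    apply le_antisymm
    · intro p hp
      have h1 := Ideal.mem_map_of_mem
        (e₀ : MvPolynomial (Fin (n + 1)) ℂ →+* MvPolynomial (Fin (n + 1)) ℂ)
        (scale_mem_coneIdeal hp b)
      have h2 : (e₀ : MvPolynomial (Fin (n + 1)) ℂ →+* MvPolynomial (Fin (n + 1)) ℂ)
          (scale b p) = p := he₀ p
      rwa [h2] at h1
    · rw [Ideal.map_le_iff_le_comap]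
      intro p hp
      exact scale_mem_coneIdeal hp b⁻¹
  let e := Ideal.quotientEquivAlg (coneIdeal X) (coneIdeal X) e₀ hI
  have he (p : MvPolynomial (Fin (n + 1)) ℂ) :
      e.symm (Ideal.Quotient.mk _ p) = Ideal.Quotient.mk _ (scale b p) := by
    rw [AlgEquiv.symm_apply_eq, Ideal.quotientEquivAlg_mk, he₀]
  refine ⟨PrimeSpectrum.comap (e.symm : _ →+* _) P, ?_, ?_⟩
  · refine mem_smoothLocus_of_algEquiv e ?_
    convert hP
    ext a
    change e.symm (e a) ∈ P.asIdeal ↔ _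
    rw [e.symm_apply_apply]
  · ext p
    have h1 : p ∈ (PrimeSpectrum.comap (e.symm : _ →+* _) P).asIdeal.comap
        (Ideal.Quotient.mk (coneIdeal X)) ↔
        e.symm (Ideal.Quotient.mk _ p) ∈ P.asIdeal := Iff.rfl
    rw [h1, he, ← Ideal.mem_comap, hPv, MvPolynomial.mem_vanishingIdeal_singleton_iff,
      MvPolynomial.mem_vanishingIdeal_singleton_iff, aeval_scale]

theorem isSmoothPoint_iff {X : Set (ProjSpace n)} {x : ProjSpace n} :
    IsSmoothPoint X x ↔ x ∈ X ∧ IsSmoothVector (coneIdeal X) x.rep := Iff.rfl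

/-- The nonzero smooth vectors of the affine cone. -/
def smoothCone (X : Set (ProjSpace n)) : Set (Fin (n + 1) → ℂ) :=
  {v | v ∈ cone X ∧ v ≠ 0 ∧ IsSmoothVector (coneIdeal X) v}

theorem mem_coneIdeal_of_forall_smoothCone {X : Set (ProjSpace n)} (hX : X.Nonempty)
    (hI : (coneIdeal X).IsPrime) {c : MvPolynomial (Fin (n + 1)) ℂ}
    (hc : ∀ v ∈ smoothCone X, MvPolynomial.aeval v c = 0) : c ∈ coneIdeal X := by
  have : Algebra.FinitePresentation ℂ (MvPolynomial (Fin (n + 1)) ℂ ⧸ coneIdeal X) :=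
    Algebra.FinitePresentation.of_finiteType.1 inferInstance
  obtain ⟨f, hf0, hf⟩ := exists_smoothLocus_of_isDomain (k := ℂ)
    (A := MvPolynomial (Fin (n + 1)) ℂ ⧸ coneIdeal X)
  obtain ⟨F, rfl⟩ := Ideal.Quotient.mk_surjective f
  have hF : F ∉ coneIdeal X := fun h => hf0 (Ideal.Quotient.eq_zero_iff_mem.2 h)
  have hsm {v : Fin (n + 1) → ℂ} (hv : v ∈ cone X) (hFv : MvPolynomial.aeval v F ≠ 0) :
      IsSmoothVector (coneIdeal X) v := by
    let φ : MvPolynomial (Fin (n + 1)) ℂ ⧸ coneIdeal X →ₐ[ℂ] ℂ :=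
      Ideal.Quotient.liftₐ (coneIdeal X) (MvPolynomial.aeval v) fun p hp => hp v hv
    refine ⟨⟨RingHom.ker φ, RingHom.ker_isPrime _⟩, hf _ hFv, ?_⟩
    ext p
    rw [MvPolynomial.mem_vanishingIdeal_singleton_iff]
    rfl
  obtain ⟨x, hx⟩ := hX
  have hXj : ∃ j, (MvPolynomial.X j : MvPolynomial (Fin (n + 1)) ℂ) ∉ coneIdeal X := by
    by_contra! h
    refine x.rep_nonzero (funext fun j => ?_)
    have := h j _ (rep_mem_cone hx)
    simpa using this
  obtain ⟨j, hj⟩ := hXj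
  -- The factor `F` handles the possibly singular vectors, the factor `X j` the vertex; neither lies
  -- in the prime ideal.
  have hprod : c * (F * MvPolynomial.X j) ∈ coneIdeal X := by
    intro v hv
    rw [map_mul, map_mul]
    by_cases hv0 : v = 0
    · simp [hv0]
    by_cases hFv : MvPolynomial.aeval v F = 0
    · rw [hFv, zero_mul, mul_zero]
    · rw [hc v ⟨hv, hv0, hsm hv hFv⟩, zero_mul]
  exact (hI.mem_or_mem hprod).resolve_right fun h => (hI.mem_or_mem h).elim hF hj

end Smooth

/-! ### Tangency and the dual variety through the generic conormal pair. -/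

section Duality

variable {n : ℕ}

theorem isTangentAt_iff {X : Set (ProjSpace n)} {x H : ProjSpace n} :
    IsTangentAt X x H ↔ H.rep ∈ conormalSpace (coneIdeal X) x.rep := by
  rw [mem_conormalSpace_iff]
  have hmem (w : Fin (n + 1) → ℂ) :
      w ∈ coneTangentSpace X x.rep ↔ w ∈ tangentSpace (coneIdeal X) x.rep := Iff.rfl
  have horth (w : Fin (n + 1) → ℂ) (hw : w ≠ 0) :
      Projectivization.mk ℂ w hw ∈ hyperplane H ↔ H.rep ⬝ᵥ w = 0 := by
    rw [← Projectivization.orthogonal_mk H.rep_nonzero hw, Projectivization.mk_rep]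
    rfl
  constructor
  · intro h w hw
    by_cases hw0 : w = 0
    · rw [hw0, dotProduct_zero]
    refine (horth w hw0).1 (h ?_)
    change (Projectivization.mk ℂ w hw0).submodule ≤ _
    rw [Projectivization.submodule_mk, Submodule.span_singleton_le_iff_mem]
    exact hw
  · intro h y hy
    induction y using Projectivization.ind with
    | h w hw0 =>
      change (Projectivization.mk ℂ w hw0).submodule ≤ _ at hy
      rw [Projectivization.submodule_mk, Submodule.span_singleton_le_iff_mem] at hy
      exact (horth w hw0).2 (h w hy)

variable {K : Type} [Field K] [Algebra ℂ K]

theorem IsSmoothVector.finrank_conormalSpace {σ : Type*} [Fintype σ] {x : σ → K} {v : σ → ℂ}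
    (h : IsSmoothVector (idealAt ℂ x) v) (hv : ∀ p ∈ idealAt ℂ x, MvPolynomial.aeval v p = 0) :
    Module.finrank ℂ (conormalSpace (idealAt ℂ x) v) =
      Module.finrank K (conormalSpace (idealAt ℂ x) x) := by
  obtain ⟨P, hP, hPv⟩ := h
  obtain ⟨d, hd⟩ := exists_finrank_tangentSpace_eq _ P hP
  have h1 := hd ℂ v hv fun p hp => by
    rw [← Ideal.mem_comap, hPv]
    exact (MvPolynomial.mem_vanishingIdeal_singleton_iff _ _).2 hp
  have h2 := hd K x (fun p hp => hp) fun p hp => by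
    rw [Ideal.Quotient.eq_zero_iff_mem.2 hp]
    exact Ideal.zero_mem _
  have h3 := finrank_conormalSpace_add_finrank_tangentSpace (idealAt ℂ x) v
  have h4 := finrank_conormalSpace_add_finrank_tangentSpace (idealAt ℂ x) x
  omega

/-- Tangency at a smooth point means that `(z, H)` is a specialization of `(x, h)`. Smoothness
serves the converse direction only, where the conormal rank at `z` must be the generic one. -/
theorem isTangentAt_iff_of_isGenericConormal {X : Set (ProjSpace n)} {x h : Fin (n + 1) → K}
    (hx : idealAt ℂ x = coneIdeal X) (hh : IsGenericConormal ℂ x h) {z H : ProjSpace n}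
    (hz : IsSmoothPoint X z) :
    IsTangentAt X z H ↔ ∀ g : MvPolynomial (Fin (n + 1) ⊕ Fin (n + 1)) ℂ,
      MvPolynomial.aeval (Sum.elim x h) g = 0 →
        MvPolynomial.aeval (Sum.elim z.rep H.rep) g = 0 := by
  have : Infinite K := Infinite.of_injective _ (algebraMap ℂ K).injective
  obtain ⟨hzX, hs⟩ := isSmoothPoint_iff.1 hz
  have hv : ∀ p ∈ idealAt ℂ x, MvPolynomial.aeval z.rep p = 0 := fun p hp =>
    (hx ▸ hp : p ∈ coneIdeal X) _ (rep_mem_cone hzX)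
  rw [← hx] at hs
  rw [isTangentAt_iff, ← hx]
  constructor
  · intro hu g hg
    exact aeval_eq_zero_of_mem_conormalSpace ((hh.aeval_eq_zero_iff g).1 hg) hv hu
  · intro hg
    exact mem_conormalSpace_of_forall_aeval_eq_zero hv (hs.finrank_conormalSpace hv)
      fun g hg' => hg g ((hh.aeval_eq_zero_iff g).2 hg')

/-- The hyperplanes that are tangent to `X` at some smooth point. -/
def tangentHyperplanes (X : Set (ProjSpace n)) : Set (ProjSpace n) :=
  {H | ∃ x, IsSmoothPoint X x ∧ IsTangentAt X x H}

theorem mem_cone_tangentHyperplanes {X : Set (ProjSpace n)} {v u : Fin (n + 1) → ℂ}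
    (hv : v ∈ smoothCone X) (hu : u ∈ conormalSpace (coneIdeal X) v) :
    u ∈ cone (tangentHyperplanes X) := by
  intro hu0
  obtain ⟨hvX, hv0, hs⟩ := hv
  obtain ⟨a, ha, hav⟩ := exists_rep_eq_smul hv0
  obtain ⟨b, -, hbu⟩ := exists_rep_eq_smul hu0
  refine ⟨Projectivization.mk ℂ v hv0, isSmoothPoint_iff.2 ⟨hvX hv0, ?_⟩, ?_⟩
  · rw [hav]
    exact hs.smul ha
  · rw [isTangentAt_iff, hav, hbu, conormalSpace_smul ha]
    exact Submodule.smul_mem _ b hu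

theorem exists_mem_conormalSpace_of_mem_cone {X : Set (ProjSpace n)} {u : Fin (n + 1) → ℂ}
    (hu : u ∈ cone (tangentHyperplanes X)) (hu0 : u ≠ 0) :
    ∃ v ∈ cone X, u ∈ conormalSpace (coneIdeal X) v := by
  obtain ⟨z, hz, hzu⟩ := hu hu0
  obtain ⟨b, hb, hbu⟩ := exists_rep_eq_smul hu0
  rw [isTangentAt_iff, hbu] at hzu
  exact ⟨z.rep, rep_mem_cone hz.1, (Submodule.smul_mem_iff _ hb).1 hzu⟩

/-- A polynomial in the second factor vanishes at `h` exactly when it vanishes on all conormal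
vectors at `x`. This passes to special points by specialization, and back by density of the smooth
cone. -/
theorem coneIdeal_tangentHyperplanes {X : Set (ProjSpace n)} (hX : X.Nonempty)
    {x h : Fin (n + 1) → K} (hx : idealAt ℂ x = coneIdeal X) (hh : IsGenericConormal ℂ x h) :
    coneIdeal (tangentHyperplanes X) = idealAt ℂ h := by
  have : Infinite K := Infinite.of_injective _ (algebraMap ℂ K).injective
  have hprime : (coneIdeal X).IsPrime := hx ▸ RingHom.ker_isPrime _
  have hD (c : MvPolynomial (Fin (n + 1)) ℂ)
      (hc : ∀ v ∈ smoothCone X, MvPolynomial.aeval v c = 0) : c ∈ idealAt ℂ x := by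
    rw [hx]
    exact mem_coneIdeal_of_forall_smoothCone hX hprime hc
  have hren {κ : Type} [Field κ] [Algebra ℂ κ] (v u : Fin (n + 1) → κ)
      (q : MvPolynomial (Fin (n + 1)) ℂ) :
      MvPolynomial.aeval (Sum.elim v u) (MvPolynomial.rename Sum.inr q) =
        MvPolynomial.aeval u q := by
    rw [MvPolynomial.aeval_rename, Sum.elim_comp_inr]
  ext q
  have key : q ∈ idealAt ℂ h ↔ ∀ u ∈ conormalSpace (idealAt ℂ x) x,
      MvPolynomial.aeval (Sum.elim x u) (MvPolynomial.rename Sum.inr q) = 0 := by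
    rw [← hh.aeval_eq_zero_iff, hren]
    rfl
  rw [key]
  constructor
  · intro hq u hu
    refine aeval_eq_zero_of_dense hD (fun v hv u hu => ?_) hu
    rw [hren]
    rw [hx] at hu
    exact hq u (mem_cone_tangentHyperplanes hv hu)
  · intro hq u hu
    have hmem {v : Fin (n + 1) → ℂ} (hv : v ∈ cone X) (hu : u ∈ conormalSpace (coneIdeal X) v) :
        MvPolynomial.aeval u q = 0 := by
      rw [← hren v u]
      refine aeval_eq_zero_of_mem_conormalSpace hq (fun p hp => ?_) (hx ▸ hu)
      rw [hx] at hp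
      exact hp v hv
    by_cases hu0 : u = 0
    · obtain ⟨z, hz⟩ := hX
      refine hmem (rep_mem_cone hz) ?_
      rw [hu0]
      exact Submodule.zero_mem _
    · obtain ⟨v, hv, huv⟩ := exists_mem_conormalSpace_of_mem_cone hu hu0
      exact hmem hv huv

theorem dotProduct_eq_zero_of_isGenericConormal {X : Set (ProjSpace n)} {x h : Fin (n + 1) → K}
    (hx : idealAt ℂ x = coneIdeal X) (hh : IsGenericConormal ℂ x h) : x ⬝ᵥ h = 0 := by
  obtain ⟨p, s, hp, -, -, -, rfl⟩ := hh
  rw [dotProduct_sum]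
  refine Finset.sum_eq_zero fun i _ => ?_
  rw [dotProduct_smul]
  have he : ∑ j, MvPolynomial.X j * MvPolynomial.pderiv j (p i) ∈ idealAt ℂ x := by
    rw [hx]
    exact euler_mem_coneIdeal (hx ▸ hp i)
  have he' : x ⬝ᵥ gradient x (p i) = 0 := by
    rw [RingHom.mem_ker] at he
    simpa [dotProduct, gradient, map_sum] using he
  rw [he', smul_zero]

theorem dualVariety_of_nonempty {X : Set (ProjSpace n)} (hX : X.Nonempty) :
    dualVariety X = closure (tangentHyperplanes X) := by
  rw [dualVariety, if_neg hX.ne_empty]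
  rfl

theorem X_mem_coneIdeal_empty (i : Fin (n + 1)) :
    MvPolynomial.X i ∈ coneIdeal (∅ : Set (ProjSpace n)) := by
  rw [mem_coneIdeal]
  intro v hv
  have hv0 : v = 0 := by
    by_contra h
    exact hv h
  simp [hv0]

theorem eq_zero_of_idealAt_eq_coneIdeal_empty {x : Fin (n + 1) → K}
    (hx : idealAt ℂ x = coneIdeal (∅ : Set (ProjSpace n))) : x = 0 := by
  funext i
  have h : MvPolynomial.X i ∈ idealAt ℂ x := hx ▸ X_mem_coneIdeal_empty i
  rw [RingHom.mem_ker] at h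
  simpa using h

theorem conormalSpace_idealAt_zero {σ : Type*} [Fintype σ] :
    conormalSpace (idealAt ℂ (0 : σ → K)) (0 : σ → K) = ⊤ := by
  classical
  rw [eq_top_iff]
  intro u _
  rw [mem_conormalSpace_iff]
  intro w hw
  have hw0 : w = 0 := by
    funext i
    have h := mem_tangentSpace.1 hw (MvPolynomial.X i) (by
      rw [RingHom.mem_ker]
      simp)
    have hg : gradient (0 : σ → K) (MvPolynomial.X i : MvPolynomial σ ℂ) = Pi.single i 1 := by
      funext j
      by_cases hij : j = i
      · subst hij
        simp [gradient]
      · simp [gradient, MvPolynomial.pderiv_X, hij, Ne.symm hij]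
    rwa [hg, single_one_dotProduct] at h
  rw [hw0, dotProduct_zero]

/-- At the vertex every vector is conormal, so a generic conormal vector there satisfies no equation
that does not hold everywhere. -/
theorem eq_univ_of_isGenericConormal_zero {X : Set (ProjSpace n)} (hX : X.Nonempty)
    (hc : IsClosed X) {x : Fin (n + 1) → K} (hx : idealAt ℂ x = coneIdeal X)
    (hh : IsGenericConormal ℂ 0 x) : X = Set.univ := by
  rw [Set.eq_univ_iff_forall]
  intro z
  rw [mem_iff_of_isClosed hX hc]
  intro p hp
  rw [← hx, RingHom.mem_ker] at hp
  have h1 := (hh.aeval_eq_zero_iff (MvPolynomial.rename Sum.inr p)).1 (by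
    rw [MvPolynomial.aeval_rename, Sum.elim_comp_inr]
    exact hp) (fun i => algebraMap ℂ K (z.rep i)) (by
      rw [conormalSpace_idealAt_zero]
      exact Submodule.mem_top)
  rw [MvPolynomial.aeval_rename, Sum.elim_comp_inr, aeval_algebraMap_fun] at h1
  exact (algebraMap ℂ K).injective (h1.trans (map_zero _).symm)

theorem coneIdeal_injOn {X Y : Set (ProjSpace n)} (hX : X.Nonempty) (hY : Y.Nonempty)
    (hXc : IsClosed X) (hYc : IsClosed Y) (h : coneIdeal X = coneIdeal Y) : X = Y := by
  ext z
  rw [mem_iff_of_isClosed hX hXc, mem_iff_of_isClosed hY hYc, h]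

theorem nonempty_of_idealAt_eq_coneIdeal {X Y : Set (ProjSpace n)} (hX : X.Nonempty)
    (h : coneIdeal Y = coneIdeal X) : Y.Nonempty := by
  rw [Set.nonempty_iff_ne_empty]
  rintro rfl
  obtain ⟨z, hz⟩ := hX
  refine z.rep_nonzero (funext fun i => ?_)
  have hi := X_mem_coneIdeal_empty i
  rw [h] at hi
  simpa using hi z.rep (rep_mem_cone hz)

theorem sumElim_comp_swap {σ τ : Type*} (a b : σ → τ) :
    Sum.elim a b ∘ Sum.swap = Sum.elim b a := by
  funext i
  cases i <;> rfl

theorem forall_aeval_sumElim_swap {σ κ : Type*} [Field κ] [Algebra ℂ κ] {x h : σ → K}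
    {v u : σ → κ}
    (H : ∀ g : MvPolynomial (σ ⊕ σ) ℂ, MvPolynomial.aeval (Sum.elim x h) g = 0 →
      MvPolynomial.aeval (Sum.elim v u) g = 0) (g : MvPolynomial (σ ⊕ σ) ℂ)
    (hg : MvPolynomial.aeval (Sum.elim h x) g = 0) :
    MvPolynomial.aeval (Sum.elim u v) g = 0 := by
  have := H (MvPolynomial.rename Sum.swap g)
  rw [MvPolynomial.aeval_rename, MvPolynomial.aeval_rename, sumElim_comp_swap,
    sumElim_comp_swap] at this
  exact this hg

end Duality

end ProjDual

theorem theorem1p7 (n : ℕ) (X : Set (ProjDual.ProjSpace n))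
    (hX : ProjDual.IsIrreducibleVariety X) :
    ProjDual.dualVariety (ProjDual.dualVariety X) = X ∧
      ∀ z H : ProjDual.ProjSpace n,
        ProjDual.IsSmoothPoint X z →
        ProjDual.IsSmoothPoint (ProjDual.dualVariety X) H →
        (ProjDual.IsTangentAt X z H ↔
          ProjDual.IsTangentAt (ProjDual.dualVariety X) H z) := by
  open ProjDual in
  obtain ⟨hXc, hXi⟩ := hX
  have hX := hXi.nonempty
  have := coneIdeal_isPrime hXi
  obtain ⟨K, _, _, _, x, h, hx, hh⟩ := exists_isGenericConormal (coneIdeal X)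
  have hh' := hh.symm (dotProduct_eq_zero_of_isGenericConormal hx hh)
  have hS := coneIdeal_tangentHyperplanes hX hx hh
  have hY := dualVariety_of_nonempty hX
  rcases (tangentHyperplanes X).eq_empty_or_nonempty with hS0 | hSne
  · rw [hS0, closure_empty] at hY
    -- The cone over the empty set is the vertex alone, so `h` satisfies all coordinate equations.
    rw [hS0] at hS
    have h0 := eq_zero_of_idealAt_eq_coneIdeal_empty hS.symm
    subst h0
    refine ⟨?_, fun z H _ hH => ?_⟩
    · rw [hY, dualVariety, if_pos rfl, eq_univ_of_isGenericConormal_zero hX hXc hx hh']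
    · exact absurd hH.1 (by simp [hY])
  · have hYne : (dualVariety X).Nonempty := hY ▸ hSne.closure
    have hYI : idealAt ℂ h = coneIdeal (dualVariety X) := by
      rw [hY, coneIdeal_closure hSne, hS]
    -- The same computation for the dual variety with the pair `(h, x)` returns the ideal of `x`,
    -- which is that of `X`.
    have hS' := (coneIdeal_tangentHyperplanes hYne hYI hh').trans hx
    have hSne' := nonempty_of_idealAt_eq_coneIdeal hX hS'
    refine ⟨?_, fun z H hz hH => ?_⟩
    · rw [dualVariety_of_nonempty hYne]
      exact coneIdeal_injOn hSne'.closure hX isClosed_closure hXc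
        ((coneIdeal_closure hSne').trans hS')
    · rw [isTangentAt_iff_of_isGenericConormal hx hh hz,
        isTangentAt_iff_of_isGenericConormal hYI hh' hH]
      exact ⟨forall_aeval_sumElim_swap, forall_aeval_sumElim_swap⟩
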